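/- In Common Matching Weight one is given two complete bipartite graphs $G_1$, $G_2$, each with two sides of equal size and with nonnegative integer edge weights, and asks whether there are perfect matchings $M_1$ of $G_1$ and $M_2$ of $G_2$ of the same total weight. For a function $f:[a]\times[b]\to\mathbb{N}$ let $X_f=\{\sum_{i=1}^{a} f(i,\sigma(i)) : \sigma:[a]\to[b]\}$; Family Intersection asks, for given $f$ and $g$, whether $X_f\cap X_g\neq\emptyset$. There is a polynomial-time many-one reduction from 3-CNF-SAT (every clause consists of three literals; an instance lists its variables and its clauses) to Common Matching Weight which maps every formula $\varphi$ with $n$ variables and $m$ clauses to an instance $(G_1,G_2)$ with $$|V(G_1)| = O\!\left(\frac{n}{\log n}\right),\qquad |V(G_2)| = O\!\left(\frac{m}{\log m}\right),$$ and such that every perfect matching of $G_1$ and every perfect matching of $G_2$ has weight less than $2^{3m}$. The constants in the $O$-bounds are absolute, and for $n<2$ (respectively $m<2$) the bound is to be read as $|V(G_1)|=O(1)$ (respectively $|V(G_2)|=O(1)$). Moreover, the reduction passes through Family Intersection in the following sense: for every $\varphi$ there are $f:[n]\times[2]\to\mathbb{N}$ and $g:[m]\times[7]\to\mathbb{N}$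 such that $\varphi$ is satisfiable if and only if $X_f\cap X_g\neq\emptyset$, and the sets of weights of all perfect matchings of $G_1$ and of $G_2$ are exactly $X_f$ and $X_g$. -/

import Mathlib

/-! Random access machines with logarithmic cost (in the style of Aho, Hopcroft and Ullman),
programmed in a structured WHILE language. The memory consists of arrays of natural numbers; a
program mentions only finitely many of them, by their constant names, and addresses their cells by
computed indices. Every instruction is charged for the bit lengths of all addresses and numbers it
handles, so that, up to a polynomial, the cost is the running time of a Turing machine. -/

namespace RAM

/-- A memory state: the content of cell `i` of array `a` is `s a i`. -/
abbrev Store : Type := ℕ → ℕ → ℕ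

/-- The arithmetic operations: addition, truncated subtraction, multiplication and integer
division (with `x / 0 = 0`). -/
inductive ArithOp : Type
  | add | sub | mul | div

def ArithOp.apply : ArithOp → ℕ → ℕ → ℕ
  | .add, x, y => x + y
  | .sub, x, y => x - y
  | .mul, x, y => x * y
  | .div, x, y => x / y

/-- Expressions: constants, the content of the cell of array `a` whose index is the value of an
expression, and arithmetic. -/
inductive Term : Type
  | const (c : ℕ)
  | read (a : ℕ) (i : Term)
  | arith (o : ArithOp) (x y : Term)

def Term.eval (s : Store) : Term → ℕ
  | .const c => c
  | .read a i => s a (i.eval s)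
  | .arith o x y => o.apply (x.eval s) (y.eval s)

/-- The cost of evaluating an expression: every node of the expression is charged one plus the bit
length of its value (so the index of a read access and the operands of an arithmetic operation are
charged as well as the result). -/
def Term.cost (s : Store) : Term → ℕ
  | .const c => Nat.size c + 1
  | .read a i => i.cost s + (Nat.size (s a (i.eval s)) + 1)
  | .arith o x y => x.cost s + y.cost s + (Nat.size (o.apply (x.eval s) (y.eval s)) + 1)

/-- Programs. A test succeeds when its value is nonzero. -/
inductive Program : Type
  | skip
  | write (a : ℕ) (i v : Term)
  | seq (p q : Program)
  | ifThenElse (e : Term) (p q : Program)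
  | whileDo (e : Term) (p : Program)

/-- Writing the number `v` into cell `i` of array `a`. -/
def Store.set (s : Store) (a i v : ℕ) : Store :=
  Function.update s a (Function.update (s a) i v)

/-- `Exec p s t s'`: the program `p`, started in the memory state `s`, halts in the memory state
`s'`, and the total logarithmic cost of the run is `t`. -/
inductive Exec : Program → Store → ℕ → Store → Prop
  | skip (s : Store) : Exec .skip s 1 s
  | write (s : Store) (a : ℕ) (i v : Term) :
      Exec (.write a i v) s (i.cost s + v.cost s + 1) (s.set a (i.eval s) (v.eval s))
  | seq {p q : Program} {s s' s'' : Store} {t t' : ℕ} :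
      Exec p s t s' → Exec q s' t' s'' → Exec (.seq p q) s (t + t' + 1) s''
  | ifTrue {e : Term} {p q : Program} {s s' : Store} {t : ℕ} :
      e.eval s ≠ 0 → Exec p s t s' → Exec (.ifThenElse e p q) s (e.cost s + t + 1) s'
  | ifFalse {e : Term} {p q : Program} {s s' : Store} {t : ℕ} :
      e.eval s = 0 → Exec q s t s' → Exec (.ifThenElse e p q) s (e.cost s + t + 1) s'
  | whileTrue {e : Term} {p : Program} {s s' s'' : Store} {t t' : ℕ} :
      e.eval s ≠ 0 → Exec p s t s' → Exec (.whileDo e p) s' t' s'' →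
      Exec (.whileDo e p) s (e.cost s + t + t' + 1) s''
  | whileFalse {e : Term} {p : Program} {s : Store} :
      e.eval s = 0 → Exec (.whileDo e p) s (e.cost s + 1) s

/-- The initial memory state on the input `l`: array `0` holds the length of `l` in cell `0`,
followed by the entries of `l`; all other cells are `0`. -/
def input (l : List ℕ) : Store :=
  fun a i => if a = 0 then (l.length :: l).getD i 0 else 0

/-- The memory state `s` presents the output `l`: array `1` holds the length of `l` in cell `0`,
followed by the entries of `l`. -/
def IsOutput (s : Store) (l : List ℕ) : Prop :=
  s 1 0 = l.length ∧ ∀ (i : ℕ) (h : i < l.length), s 1 (i + 1) = l[i]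

/-- The bit size of a list of natural numbers, each entry being charged its bit length plus one
separating symbol. -/
def bitSize (l : List ℕ) : ℕ := (l.map fun x => Nat.size x + 1).sum

/-- With inputs and outputs represented by lists of natural numbers, `f` is computed by some
program whose cost is bounded by a polynomial in the bit size of the input. -/
def PolyTimeComputable {α β : Type} (codeIn : α → List ℕ) (codeOut : β → List ℕ) (f : α → β) :
    Prop :=
  ∃ (p : Program) (bound : Polynomial ℕ), ∀ x : α, ∃ (t : ℕ) (s : Store),
    Exec p (input (codeIn x)) t s ∧ IsOutput s (codeOut (f x)) ∧
      t ≤ bound.eval (bitSize (codeIn x))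

end RAM

/-- `f` is a polynomial-time (many-one) reduction from the decision problem with instances `α`
and yes-instances `P` to the decision problem with instances `β` and yes-instances `Q`. -/
def IsPolyTimeReduction {α β : Type} (codeIn : α → List ℕ) (P : α → Prop)
    (codeOut : β → List ℕ) (Q : β → Prop) (f : α → β) : Prop :=
  RAM.PolyTimeComputable codeIn codeOut f ∧ ∀ x, P x ↔ Q (f x)

/-- An instance of 3-CNF-SAT: `numClauses` clauses over `numVars` variables, each clause having
three literals. The literal `(v, true)` is the variable `v`, and `(v, false)` is its negation. -/
structure ThreeCNF where
  numVars : ℕ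
  numClauses : ℕ
  clause : Fin numClauses → Fin 3 → Fin numVars × Bool

def ThreeCNF.Satisfiable (φ : ThreeCNF) : Prop :=
  ∃ τ : Fin φ.numVars → Bool, ∀ i, ∃ j, τ (φ.clause i j).1 = (φ.clause i j).2

def codeLiteral {n : ℕ} (l : Fin n × Bool) : ℕ := 2 * (l.1 : ℕ) + l.2.toNat

/-- The input representation of a formula: the number of variables, the list of the variables, the
number of clauses, and the literals of the clauses one after another. In particular its size is at
least the number of variables. -/
def ThreeCNF.code (φ : ThreeCNF) : List ℕ :=
  φ.numVars :: (List.range φ.numVars ++ φ.numClauses ::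
    List.ofFn fun k : Fin (φ.numClauses * 3) => codeLiteral (φ.clause k.divNat k.modNat))

/-- A complete bipartite graph with both sides of the same size, and with a nonnegative integer
weight on every edge. -/
structure WeightedBipartite where
  side : ℕ
  weight : Fin side → Fin side → ℕ

namespace WeightedBipartite

/-- The number of vertices (of both sides together). -/
def numVertices (G : WeightedBipartite) : ℕ := 2 * G.side

/-- A set of edges is a perfect matching if every vertex, on either side, lies on exactly one of
its edges. -/
def IsPerfectMatching (G : WeightedBipartite) (M : Finset (Fin G.side × Fin G.side)) : Prop :=
  (∀ v, ∃! e, e ∈ M ∧ e.1 = v) ∧ (∀ w, ∃! e, e ∈ M ∧ e.2 = w)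

def matchingWeight (G : WeightedBipartite) (M : Finset (Fin G.side × Fin G.side)) : ℕ :=
  ∑ e ∈ M, G.weight e.1 e.2

/-- The set of the weights of all perfect matchings. -/
def matchingWeights (G : WeightedBipartite) : Set ℕ :=
  {x | ∃ M, G.IsPerfectMatching M ∧ G.matchingWeight M = x}

/-- The representation of a weighted graph: the size of a side, then the weights row by row. -/
def code (G : WeightedBipartite) : List ℕ :=
  G.side :: List.ofFn fun k : Fin (G.side * G.side) => G.weight k.divNat k.modNat

end WeightedBipartite

/-- An instance of Common Matching Weight. -/
structure CommonMatchingWeight where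
  G₁ : WeightedBipartite
  G₂ : WeightedBipartite

/-- The yes-instances: there are perfect matchings of the two graphs of the same weight. -/
def CommonMatchingWeight.IsYes (J : CommonMatchingWeight) : Prop :=
  ∃ M₁ M₂, J.G₁.IsPerfectMatching M₁ ∧ J.G₂.IsPerfectMatching M₂ ∧
    J.G₁.matchingWeight M₁ = J.G₂.matchingWeight M₂

def CommonMatchingWeight.code (J : CommonMatchingWeight) : List ℕ := J.G₁.code ++ J.G₂.code

/-- The `f`-family `X_f`, the set of the sums `∑ i, f (i, σ i)` over all functions `σ`. -/
def family {a b : ℕ} (f : Fin a → Fin b → ℕ) : Set ℕ :=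
  {x | ∃ σ : Fin a → Fin b, x = ∑ i, f i (σ i)}

/-! Satisfiability becomes an equality of octal numbers. The `k`-th literal occurrence gets place
value `2 ^ k`; an assignment selects one literal per variable and sums the place values of its
occurrences. The `i`-th octal digit of the sum records which literals of clause `i` are true. Thus
the formula is satisfiable iff some such sum has only nonzero octal digits, that is, lies in the
family choosing a digit from 1 to 7 for every clause (`ThreeCNF.satisfiable_iff`).

To realise a family of `N` summands with `r` options each as the matching weights of a graph of side
only `O(N / log N)`, each row must encode about `log N` choices. Let `q` be prime and index rows by
pairs `(a, b)` and columns by points `(x, y)` of the plane over `ℤ/q`. The edge from `(a, b)` to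
`(x, y)` has value `y + a x² + b x`, whose base `r` digits decide `Nat.log r q` summands at once.
Any permutation gives legal digits, so every matching weight lies in the family. Conversely,
prescribed values ask each row to be matched into the graph of a quadratic function: `q` points,
with two distinct rows sharing at most 2. For up to `q (q - 1) / 2` rows Hall's condition follows by
a second moment count (`card_le_card_biUnion_of_inter_le`), so a system of distinct columns exists
(`exists_perm_curveValue`). The other rows carry weight zero and accept any column. This gives
`matchingWeights_familyGraph`.

The least suitable prime `q` satisfies `q² log N = O(N)` by Bertrand's postulate
(`planeOrder_sq_mul_log_le`). For computability, an explicit program finds `q` by trial and writes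
both matrices. All its numbers have bit length linear in the input size, so a polynomial bound on
the number of steps suffices. -/

/-! ### Hall's condition by double counting. -/

/-- Sets of the same size with small pairwise intersections satisfy Hall's condition. -/
theorem card_le_card_biUnion_of_inter_le {ι α : Type*} [DecidableEq ι] [DecidableEq α]
    (I : Finset ι) (A : ι → Finset α) (q : ℕ) (hA : ∀ i ∈ I, (A i).card = q)
    (hI : ∀ i ∈ I, ∀ j ∈ I, i ≠ j → (A i ∩ A j).card ≤ 2) (hs : 2 * I.card ≤ q * (q - 1)) :
    I.card ≤ (I.biUnion A).card := by
  by_contra! hlt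
  set U := I.biUnion A with hU
  set d : α → ℕ := fun u => ∑ i ∈ I, if u ∈ A i then 1 else 0 with hd
  have hsub : ∀ i ∈ I, A i ⊆ U := fun i hi => Finset.subset_biUnion_of_mem A hi
  have h1 : ∑ u ∈ U, d u = I.card * q := by
    rw [Finset.sum_comm, Finset.sum_const_nat]
    intro i hi
    rw [Finset.sum_ite_mem, Finset.inter_eq_right.2 (hsub i hi)]
    simp [hA i hi]
  have h2 : ∑ u ∈ U, d u ^ 2 = ∑ i ∈ I, ∑ j ∈ I, (A i ∩ A j).card := by
    simp only [hd, sq, Finset.sum_mul_sum]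
    rw [Finset.sum_comm]
    refine Finset.sum_congr rfl fun i hi => ?_
    rw [Finset.sum_comm]
    refine Finset.sum_congr rfl fun j hj => ?_
    have : ∀ u, ((if u ∈ A i then 1 else 0) * (if u ∈ A j then 1 else 0) : ℕ)
        = if u ∈ A i ∩ A j then 1 else 0 := by
      intro u; by_cases h : u ∈ A i <;> by_cases h' : u ∈ A j <;> simp [h, h']
    simp only [this]
    rw [Finset.sum_ite_mem, Finset.inter_eq_right.2
      (Finset.inter_subset_left.trans (hsub i hi))]
    simp
  have h3 : ∑ i ∈ I, ∑ j ∈ I, (A i ∩ A j).card ≤ I.card * (q + 2 * (I.card - 1)) := by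
    refine (Finset.sum_le_card_nsmul _ _ _ fun i hi => ?_).trans (le_of_eq (smul_eq_mul _ _))
    rw [← Finset.add_sum_erase _ _ hi, Finset.inter_self, hA i hi]
    refine Nat.add_le_add_left ?_ _
    refine (Finset.sum_le_card_nsmul _ _ 2 fun j hj => ?_).trans ?_
    · exact hI i hi j (Finset.mem_of_mem_erase hj) (Finset.ne_of_mem_erase hj).symm
    · rw [Finset.card_erase_of_mem hi, smul_eq_mul, mul_comm]
  -- Cauchy–Schwarz: few points would force large degrees `d u`, hence large pairwise intersections.
  have h4 := sq_sum_le_card_mul_sum_sq (s := U) (f := d)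
  rw [h1, h2] at h4
  have h5 := h4.trans (Nat.mul_le_mul_left _ h3)
  obtain ⟨s, hsI⟩ : ∃ s, I.card = s + 1 := ⟨I.card - 1, by omega⟩
  rw [hsI] at h5 hs hlt
  have h6 : U.card * ((s + 1) * (q + 2 * (s + 1 - 1))) ≤ s * ((s + 1) * (q + 2 * s)) :=
    Nat.mul_le_mul (by omega) (by simp)
  have h7 : ((s + 1) * q ^ 2) * (s + 1) ≤ (s * (q + 2 * s)) * (s + 1) := by
    calc _ = ((s + 1) * q) ^ 2 := by ring
      _ ≤ _ := h5.trans h6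
      _ = _ := by ring
  have h8 := Nat.le_of_mul_le_mul_right h7 (Nat.succ_pos s)
  obtain ⟨p, rfl⟩ : ∃ p, q = p + 1 := ⟨q - 1, by
    rcases q with _ | q
    · simp at hs
    · simp⟩
  rw [Nat.add_sub_cancel] at hs
  -- With `|I| = s + 1` the size hypothesis gives `q + 2 s < q ^ 2`, contradicting `h8`.
  nlinarith

/-! ### Quadratic curves over `ℤ/q`. -/

/-- The value at the column `j` of the function attached to the row `i` of a square grid of side
`q * q`: rows are quadratic functions `y + a x² + b x` on the affine plane over `ℤ/q`, and columns
are its points `(x, y)`. -/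
def curveValue (q i j : ℕ) : ℕ :=
  (j % q + i / q * (j / q) ^ 2 + i % q * (j / q)) % q

theorem curveValue_lt {q : ℕ} (hq : 0 < q) (i j : ℕ) : curveValue q i j < q := Nat.mod_lt _ hq

theorem curveValue_injOn {q : ℕ} (i c : ℕ) {j k : ℕ} (hj : curveValue q i j = c)
    (hk : curveValue q i k = c) (h : j / q = k / q) : j = k := by
  have : (j % q + (i / q * (j / q) ^ 2 + i % q * (j / q))) ≡
      (k % q + (i / q * (j / q) ^ 2 + i % q * (j / q))) [MOD q] := by
    unfold curveValue at hj hk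
    rw [← h] at hk
    rw [Nat.ModEq, ← add_assoc, ← add_assoc, hj, hk]
  have h' := Nat.ModEq.add_right_cancel' _ this
  simp only [Nat.ModEq, Nat.mod_mod] at h'
  rw [← Nat.div_add_mod j q, ← Nat.div_add_mod k q, h, h']

/-- The points of a curve. -/
def curve (q i c : ℕ) : Finset (Fin (q * q)) :=
  Finset.univ.filter fun j => curveValue q i j = c

/-- A curve is the graph of a function of `x = j / q`, so projecting to `x` is a bijection onto
`range q`. -/
theorem card_curve {q : ℕ} (hq : 0 < q) (i : ℕ) {c : ℕ} (hc : c < q) :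
    (curve q i c).card = q := by
  have hinj : Set.InjOn (fun j : Fin (q * q) => (j : ℕ) / q) (curve q i c : Set (Fin (q * q))) := by
    intro j hj k hk h
    simp only [curve, Finset.coe_filter, Finset.mem_univ, true_and, Set.mem_ofPred_eq] at hj hk
    exact Fin.ext (curveValue_injOn i c hj hk h)
  rw [← Finset.card_image_of_injOn hinj]
  suffices (curve q i c).image (fun j : Fin (q * q) => (j : ℕ) / q) = Finset.range q by
    rw [this, Finset.card_range]
  ext x
  simp only [Finset.mem_image, Finset.mem_range, curve, Finset.mem_filter, Finset.mem_univ,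
    true_and]
  constructor
  · rintro ⟨j, -, rfl⟩
    exact Nat.div_lt_of_lt_mul j.2
  · intro hx
    set h := i / q * x ^ 2 + i % q * x with hh
    -- This is `c - h` modulo `q`, arranged to avoid truncated subtraction.
    set y := (c + (q - h % q)) % q with hy
    have hyq : y < q := Nat.mod_lt _ hq
    have hlt : q * x + y < q * q := by nlinarith
    have hd : (q * x + y) / q = x := by
      rw [Nat.mul_add_div hq, Nat.div_eq_of_lt hyq, add_zero]
    have hm : (q * x + y) % q = y := by
      rw [Nat.mul_add_mod, Nat.mod_eq_of_lt hyq]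
    refine ⟨⟨q * x + y, hlt⟩, ?_, hd⟩
    simp only [curveValue, hd, hm]
    have := Nat.mod_lt h hq
    have e : (q - h % q + h) % q = 0 := by
      conv_lhs => rw [← Nat.mod_add_div h q, ← add_assoc]
      rw [Nat.add_mul_mod_self_left, Nat.mod_add_div h q, Nat.sub_add_cancel this.le, Nat.mod_self]
    rw [add_assoc, ← hh, hy, Nat.mod_add_mod, add_assoc, Nat.add_mod, e]
    simp [Nat.mod_eq_of_lt hc]

/-- The abscissas of common points are roots of the difference of the two quadratics. This is
nonzero because `i ≠ i'` makes the linear or quadratic coefficients differ, whatever `c` and `c'`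
are. -/
theorem card_curve_inter_le {q : ℕ} (hq : q.Prime) {i i' : ℕ} (hi : i < q * q) (hi' : i' < q * q)
    (hne : i ≠ i') (c c' : ℕ) : (curve q i c ∩ curve q i' c').card ≤ 2 := by
  have : Fact q.Prime := ⟨hq⟩
  set P : Polynomial (ZMod q) := Polynomial.C (((i / q : ℕ) : ZMod q) - (i' / q : ℕ)) * Polynomial.X ^ 2
    + Polynomial.C (((i % q : ℕ) : ZMod q) - (i' % q : ℕ)) * Polynomial.X
    + Polynomial.C ((c' : ZMod q) - c) with hP
  have cast_inj : ∀ a b : ℕ, a < q → b < q → ((a : ZMod q) - b = 0) → a = b := by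
    intro a b ha hb h
    rw [sub_eq_zero, ZMod.natCast_eq_natCast_iff'] at h
    rwa [Nat.mod_eq_of_lt ha, Nat.mod_eq_of_lt hb] at h
  have hP0 : P ≠ 0 := by
    intro h0
    have h2 : P.coeff 2 = 0 := by rw [h0]; simp
    have h1 : P.coeff 1 = 0 := by rw [h0]; simp
    rw [hP, Polynomial.coeff_add, Polynomial.coeff_add] at h1 h2
    simp only [Polynomial.coeff_C_mul, Polynomial.coeff_X_pow, Polynomial.coeff_X,
      Polynomial.coeff_C] at h1 h2
    norm_num at h1 h2
    have e1 := cast_inj _ _ (Nat.div_lt_of_lt_mul hi) (Nat.div_lt_of_lt_mul hi') (by simpa using h2)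
    have e2 := cast_inj _ _ (Nat.mod_lt _ hq.pos) (Nat.mod_lt _ hq.pos) (by simpa using h1)
    exact hne (by rw [← Nat.div_add_mod i q, ← Nat.div_add_mod i' q, e1, e2])
  have hroots : P.roots.toFinset.card ≤ 2 :=
    (Multiset.toFinset_card_le _).trans ((Polynomial.card_roots' P).trans
      Polynomial.natDegree_quadratic_le)
  refine le_trans (Finset.card_le_card_of_injOn
    (fun j : Fin (q * q) => (((j : ℕ) / q : ℕ) : ZMod q)) ?_ ?_) hroots
  · intro j hj
    simp only [curve, Finset.coe_inter, Finset.coe_filter, Finset.mem_univ, true_and,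
      Set.mem_inter_iff, Set.mem_ofPred_eq] at hj
    simp only [Finset.mem_coe, Multiset.mem_toFinset, Polynomial.mem_roots hP0, Polynomial.IsRoot.def]
    have key : ∀ i c : ℕ, curveValue q i j = c →
        (((j : ℕ) % q : ℕ) : ZMod q) + (i / q : ℕ) * ((j : ℕ) / q : ℕ) ^ 2
          + (i % q : ℕ) * ((j : ℕ) / q : ℕ) = c := by
      rintro i c rfl
      simp [curveValue]
    have k1 := key _ _ hj.1
    have k2 := key _ _ hj.2
    rw [hP]
    simp only [Polynomial.eval_add, Polynomial.eval_mul, Polynomial.eval_C, Polynomial.eval_pow,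
      Polynomial.eval_X]
    linear_combination k1 - k2
  · intro j hj k hk h
    simp only [curve, Finset.coe_inter, Finset.coe_filter, Finset.mem_univ, true_and,
      Set.mem_inter_iff, Set.mem_ofPred_eq] at hj hk
    refine Fin.ext (curveValue_injOn i c hj.1 hk.1 ?_)
    simp only at h
    rw [ZMod.natCast_eq_natCast_iff', Nat.mod_eq_of_lt (Nat.div_lt_of_lt_mul j.2),
      Nat.mod_eq_of_lt (Nat.div_lt_of_lt_mul k.2)] at h
    exact h

/-- Hall's theorem, with the unprescribed rows admitting every column. A set of rows containing one
of these satisfies Hall's condition trivially, and the rest is the counting lemma. -/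
theorem exists_perm_curveValue {q : ℕ} (hq : q.Prime) (c : ℕ → ℕ) (hc : ∀ i, c i < q) :
    ∃ σ : Equiv.Perm (Fin (q * q)), ∀ i : Fin (q * q), 2 * (i : ℕ) < q * (q - 1) →
      curveValue q i (σ i) = c i := by
  set A : Fin (q * q) → Finset (Fin (q * q)) := fun i =>
    if 2 * (i : ℕ) < q * (q - 1) then curve q i (c i) else Finset.univ with hA
  have hall : ∀ I : Finset (Fin (q * q)), I.card ≤ (I.biUnion A).card := by
    intro I
    by_cases h : ∀ i ∈ I, 2 * (i : ℕ) < q * (q - 1)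
    · refine card_le_card_biUnion_of_inter_le I A q ?_ ?_ ?_
      · intro i hi
        simp only [hA, if_pos (h i hi), card_curve hq.pos _ (hc _)]
      · intro i hi j hj hij
        simp only [hA, if_pos (h i hi), if_pos (h j hj)]
        exact card_curve_inter_le hq i.2 j.2 (fun e => hij (Fin.ext e)) _ _
      -- Evenness turns `2 * i < q * (q - 1)` into `i < e`, which bounds the number of prescribed
      -- rows.
      · have heven : Even (q * (q - 1)) := Nat.even_mul_pred_self q
        obtain ⟨e, he⟩ := heven
        have : I.card ≤ (Finset.range e).card := by
          refine Finset.card_le_card_of_injOn (fun i : Fin (q * q) => (i : ℕ)) ?_ ?_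
          · intro i hi
            have := h i hi
            simp only [Finset.coe_range, Set.mem_Iio]
            omega
          · intro i _ j _ hij
            exact Fin.ext hij
        rw [Finset.card_range] at this
        omega
    · push Not at h
      obtain ⟨i, hi, hlt⟩ := h
      have : A i ⊆ I.biUnion A := Finset.subset_biUnion_of_mem A hi
      simp only [hA, if_neg (not_lt.2 hlt)] at this
      exact Finset.card_le_card ((Finset.subset_univ I).trans this)
  obtain ⟨g, hg, hgA⟩ := (Finset.all_card_le_biUnion_card_iff_exists_injective A).1 hall
  refine ⟨Equiv.ofBijective g (Finite.injective_iff_bijective.1 hg), fun i hi => ?_⟩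
  have := hgA i
  simp only [hA, if_pos hi, curve, Finset.mem_filter, Finset.mem_univ, true_and] at this
  exact this

/-! ### Perfect matchings as permutations. -/

namespace WeightedBipartite

theorem mem_matchingWeights_iff (G : WeightedBipartite) (x : ℕ) :
    x ∈ G.matchingWeights ↔ ∃ σ : Equiv.Perm (Fin G.side), ∑ i, G.weight i (σ i) = x := by
  constructor
  · rintro ⟨M, ⟨h1, h2⟩, rfl⟩
    choose e he hu using h1
    simp only at he hu
    have hbij : Function.Bijective fun v => (e v).2 := by
      refine Finite.injective_iff_bijective.1 fun v w hvw => ?_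
      have := (h2 (e v).2).unique ⟨(he v).1, rfl⟩ ⟨(he w).1, hvw.symm⟩
      rw [← (he v).2, ← (he w).2, this]
    refine ⟨Equiv.ofBijective _ hbij, ?_⟩
    have hM : M = Finset.univ.image e := by
      ext p
      simp only [Finset.mem_image, Finset.mem_univ, true_and]
      constructor
      · intro hp
        exact ⟨p.1, ((hu p.1) p ⟨hp, rfl⟩).symm⟩
      · rintro ⟨v, rfl⟩
        exact (he v).1
    unfold matchingWeight
    rw [hM, Finset.sum_image]
    · refine Finset.sum_congr rfl fun v _ => ?_
      rw [(he v).2]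
      rfl
    · intro v _ w _ hvw
      rw [← (he v).2, ← (he w).2, hvw]
  · rintro ⟨σ, rfl⟩
    refine ⟨Finset.univ.image fun v => (v, σ v), ⟨fun v => ⟨(v, σ v), by simp, ?_⟩,
      fun w => ⟨(σ.symm w, w), by simp, ?_⟩⟩, ?_⟩
    · rintro ⟨a, b⟩ ⟨h, rfl⟩
      simp only [Finset.mem_image, Finset.mem_univ, true_and, Prod.mk.injEq] at h
      obtain ⟨_, rfl, rfl⟩ := h
      rfl
    · rintro ⟨a, b⟩ ⟨h, rfl⟩
      simp only [Finset.mem_image, Finset.mem_univ, true_and, Prod.mk.injEq] at h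
      obtain ⟨_, rfl, rfl⟩ := h
      simp
    · unfold matchingWeight
      rw [Finset.sum_image]
      intro v _ w _ h
      exact (Prod.mk.inj h).1

end WeightedBipartite

/-! ### Families as sets of matching weights. -/

theorem sum_range_mul_add (h : ℕ → ℕ) (A b : ℕ) :
    ∑ i ∈ Finset.range A, ∑ t ∈ Finset.range b, h (i * b + t) = ∑ u ∈ Finset.range (A * b), h u := by
  induction A with
  | zero => simp
  | succ A ih =>
    rw [Finset.sum_range_succ, ih, Nat.succ_mul, Finset.sum_range_add]

theorem exists_digits {r : ℕ} (hr : 0 < r) (b : ℕ) (ρ : ℕ → ℕ) (hρ : ∀ t, ρ t < r) :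
    ∃ c, c < r ^ b ∧ ∀ t < b, c / r ^ t % r = ρ t := by
  induction b generalizing ρ with
  | zero => exact ⟨0, by simp, by simp⟩
  | succ b ih =>
    obtain ⟨c, hc, hd⟩ := ih (fun t => ρ (t + 1)) fun t => hρ _
    refine ⟨ρ 0 + r * c, ?_, ?_⟩
    · have := hρ 0
      calc ρ 0 + r * c < r + r * c := by omega
        _ = r * (c + 1) := by ring
        _ ≤ r * r ^ b := Nat.mul_le_mul_left _ hc
        _ = r ^ (b + 1) := by ring
    · rintro (_ | t) ht
      · simp [Nat.mod_eq_of_lt (hρ 0)]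
      · rw [pow_succ', ← Nat.div_div_eq_div_mul, Nat.add_mul_div_left _ _ hr,
          Nat.div_eq_of_lt (hρ 0), zero_add]
        exact hd t (by omega)

/-- The contribution of the `u`-th summand of a family when its digit is `d`; it is `0` for
`N ≤ u`. -/
def digitWeight (r N : ℕ) (F : ℕ → ℕ) (u d : ℕ) : ℕ := F (r * u + d) * (1 - (u + 1 - N))

/-- The weight of the edge `(i, j)`: the base `r` digits of the curve value select one term each
from the `i`-th block of summands. -/
def edgeWeight (r N q : ℕ) (F : ℕ → ℕ) (i j : ℕ) : ℕ :=
  ∑ t ∈ Finset.range (Nat.log r q),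
    digitWeight r N F (i * Nat.log r q + t) (curveValue q i j / r ^ t % r)

/-- The weighted graph whose matching weights form a given family. -/
def familyGraph (r N q : ℕ) (F : ℕ → ℕ) : WeightedBipartite where
  side := q * q
  weight i j := edgeWeight r N q F i j

/-- A matching selects exactly one digit for each of the `N` summands. Conversely, any `Nat.log r q`
digits form a number below `q`, and the bound on `N` puts every row with a live summand among those
whose value can be prescribed. -/
theorem matchingWeights_familyGraph {r N q : ℕ} (F : ℕ → ℕ) (hr : 0 < r) (hq : q.Prime)
    (hN : 2 * N ≤ q * (q - 1) * Nat.log r q) :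
    (familyGraph r N q F).matchingWeights =
      family fun (v : Fin N) (d : Fin r) => F (r * v + d) := by
  set b := Nat.log r q with hb
  have hNle : N ≤ q * q * b := by
    have : q * (q - 1) * b ≤ q * q * b :=
      Nat.mul_le_mul_right _ (Nat.mul_le_mul_left _ (Nat.sub_le _ _))
    omega
  -- The weight depends on `σ` only through the digits below `N`; the positions from `N` on
  -- contribute zero.
  have hsum : ∀ σ : Equiv.Perm (Fin (q * q)), ∀ D : ℕ → ℕ,
      (∀ i : Fin (q * q), ∀ t < b, i * b + t < N →
        curveValue q i (σ i) / r ^ t % r = D (i * b + t)) →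
      ∑ i : Fin (q * q), edgeWeight r N q F i (σ i) = ∑ v : Fin N, F (r * v + D v) := by
    intro σ D hD
    have h1 : ∀ i : Fin (q * q), edgeWeight r N q F i (σ i) =
        ∑ t ∈ Finset.range b, digitWeight r N F (i * b + t) (D (i * b + t)) := by
      intro i
      unfold edgeWeight
      refine Finset.sum_congr rfl fun t ht => ?_
      rw [Finset.mem_range] at ht
      by_cases h : i * b + t < N
      · rw [hD i t ht h]
      · have : 1 - ((i : ℕ) * b + t + 1 - N) = 0 := by omega
        simp [digitWeight, ← hb, this]
    rw [Finset.sum_congr rfl fun i _ => h1 i,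
      Fin.sum_univ_eq_sum_range
        (fun i => ∑ t ∈ Finset.range b, digitWeight r N F (i * b + t) (D (i * b + t))),
      sum_range_mul_add (fun u => digitWeight r N F u (D u)),
      ← Finset.sum_range_add_sum_Ico _ hNle, Fin.sum_univ_eq_sum_range (fun v => F (r * v + D v))]
    have h2 : ∑ u ∈ Finset.Ico N (q * q * b), digitWeight r N F u (D u) = 0 := by
      refine Finset.sum_eq_zero fun u hu => ?_
      have : 1 - (u + 1 - N) = 0 := by have := (Finset.mem_Ico.1 hu).1; omega
      simp [digitWeight, this]
    rw [h2, add_zero]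
    refine Finset.sum_congr rfl fun u hu => ?_
    have : 1 - (u + 1 - N) = 1 := by have := Finset.mem_range.1 hu; omega
    simp [digitWeight, this]
  have hdiv : ∀ i t : ℕ, t < b → (i * b + t) / b = i ∧ (i * b + t) % b = t := by
    intro i t ht
    constructor
    · rw [mul_comm, Nat.mul_add_div (by omega), Nat.div_eq_of_lt ht, add_zero]
    · rw [mul_comm, Nat.mul_add_mod, Nat.mod_eq_of_lt ht]
  ext x
  rw [WeightedBipartite.mem_matchingWeights_iff]
  constructor
  · rintro ⟨σ, rfl⟩
    change Equiv.Perm (Fin (q * q)) at σ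
    -- Position `u` is digit `u % b` of row `u / b`.
    set D : ℕ → ℕ := fun u => if h : u / b < q * q then
      curveValue q (u / b) (σ ⟨u / b, h⟩) / r ^ (u % b) % r else 0 with hDdef
    have hDlt : ∀ u, D u < r := by
      intro u
      simp only [hDdef]
      split_ifs
      · exact Nat.mod_lt _ hr
      · exact hr
    refine ⟨fun v => ⟨D v, hDlt v⟩, hsum σ D fun i t ht _ => ?_⟩
    obtain ⟨e1, e2⟩ := hdiv i t ht
    have : ((i : ℕ) * b + t) / b < q * q := by rw [e1]; exact i.2
    simp only [hDdef, dif_pos this, e1, e2]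
  · rintro ⟨ρ, rfl⟩
    set D : ℕ → ℕ := fun u => if h : u < N then (ρ ⟨u, h⟩ : ℕ) else 0 with hDdef
    have hDlt : ∀ u, D u < r := by
      intro u
      simp only [hDdef]
      split_ifs
      · exact (ρ _).2
      · exact hr
    choose c hc hcd using fun i => exists_digits hr b (fun t => D (i * b + t)) fun t => hDlt _
    obtain ⟨σ, hσ⟩ := exists_perm_curveValue hq c fun i =>
      (hc i).trans_le (Nat.pow_log_le_self r hq.ne_zero)
    refine ⟨σ, (hsum σ D fun i t ht hlt => ?_).trans ?_⟩
    · rw [hσ i, hcd i t ht]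
      -- Since `i * b + t < N`, row `i` lies in the prescribed half.
      have h1 : 2 * (i : ℕ) * b < q * (q - 1) * b := by nlinarith
      exact lt_of_mul_lt_mul_right h1 (Nat.zero_le _)
    · refine Finset.sum_congr rfl fun v _ => ?_
      simp [hDdef]

/-! ### Octal encoding of clauses. -/

theorem sum_octal_lt (m : ℕ) (x : Fin m → ℕ) (hx : ∀ i, x i < 8) :
    ∑ i : Fin m, 8 ^ (i : ℕ) * x i < 8 ^ m := by
  induction m with
  | zero => simp
  | succ m ih =>
    rw [Fin.sum_univ_castSucc]
    have h1 := ih (fun i => x i.castSucc) fun i => hx _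
    have h2 := Nat.mul_le_mul_left (8 ^ m) (Nat.le_of_lt_succ (hx (Fin.last m)))
    simp only [Fin.val_castSucc, Fin.val_last, pow_succ]
    omega

theorem sum_octal_injective (m : ℕ) (x y : Fin m → ℕ) (hx : ∀ i, x i < 8) (hy : ∀ i, y i < 8)
    (h : ∑ i : Fin m, 8 ^ (i : ℕ) * x i = ∑ i : Fin m, 8 ^ (i : ℕ) * y i) : x = y := by
  induction m with
  | zero => exact Subsingleton.elim _ _
  | succ m ih =>
    rw [Fin.sum_univ_castSucc, Fin.sum_univ_castSucc] at h
    have h1 := sum_octal_lt m (fun i => x i.castSucc) fun i => hx _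
    have h2 := sum_octal_lt m (fun i => y i.castSucc) fun i => hy _
    simp only [Fin.val_castSucc, Fin.val_last] at h
    have hlast : x (Fin.last m) = y (Fin.last m) := by
      have := congrArg (· / 8 ^ m) h
      simpa [Nat.add_mul_div_left, Nat.div_eq_of_lt h1, Nat.div_eq_of_lt h2] using this
    rw [hlast, Nat.add_right_cancel_iff] at h
    have := ih _ _ (fun i => hx _) (fun i => hy _) h
    funext i
    refine Fin.lastCases hlast (fun i => ?_) i
    exact congrFun this i

namespace ThreeCNF

variable (φ : ThreeCNF)

/-- The sum of the place values of the occurrences of the literal with code `c`. -/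
def literalWeight (c : ℕ) : ℕ :=
  ∑ k : Fin (φ.numClauses * 3),
    if codeLiteral (φ.clause k.divNat k.modNat) = c then 2 ^ (k : ℕ) else 0

/-- The truth values of the literals of the `i`-th clause, as a number below `8`. -/
def truthPattern (σ : Fin φ.numVars → Fin 2) (i : Fin φ.numClauses) : ℕ :=
  ∑ j : Fin 3, if (σ (φ.clause i j).1 : ℕ) = (φ.clause i j).2.toNat then 2 ^ (j : ℕ) else 0

variable {φ}

theorem truthPattern_lt (σ : Fin φ.numVars → Fin 2) (i : Fin φ.numClauses) :
    φ.truthPattern σ i < 8 := by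
  unfold truthPattern
  rw [Fin.sum_univ_three]
  split_ifs <;> simp

theorem truthPattern_ne_zero_iff (σ : Fin φ.numVars → Fin 2) (i : Fin φ.numClauses) :
    φ.truthPattern σ i ≠ 0 ↔
      ∃ j, (σ (φ.clause i j).1 : ℕ) = (φ.clause i j).2.toNat := by
  simp [truthPattern, Finset.sum_eq_zero_iff]

/-- Each occurrence is counted only at its own variable, and only if `σ` makes it true. Grouping the
place values `2 ^ (3 i + j) = 8 ^ i * 2 ^ j` by clauses gives octal digits. -/
theorem sum_literalWeight (σ : Fin φ.numVars → Fin 2) :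
    ∑ v, φ.literalWeight (2 * v + σ v) =
      ∑ i : Fin φ.numClauses, 8 ^ (i : ℕ) * φ.truthPattern σ i := by
  have h1 : ∀ l : Fin φ.numVars × Bool, ∀ w : ℕ,
      (∑ v : Fin φ.numVars, if codeLiteral l = 2 * (v : ℕ) + σ v then w else 0) =
        if (σ l.1 : ℕ) = l.2.toNat then w else 0 := by
    rintro ⟨u, s⟩ w
    have hs : s.toNat < 2 := Bool.toNat_lt s
    rw [Finset.sum_eq_single u]
    · simp only [codeLiteral, Nat.add_left_cancel_iff]
      exact if_congr eq_comm rfl rfl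
    · intro v _ hv
      refine if_neg fun h => hv (Fin.ext ?_)
      have := (σ v).2
      simp only [codeLiteral] at h
      omega
    · simp
  unfold literalWeight
  rw [Finset.sum_comm]
  simp only [h1]
  rw [← finProdFinEquiv.sum_comp, Fintype.sum_prod_type]
  refine Finset.sum_congr rfl fun i _ => ?_
  unfold truthPattern
  rw [Finset.mul_sum]
  refine Finset.sum_congr rfl fun j _ => ?_
  have h2 : (finProdFinEquiv (i, j)).divNat = i ∧ (finProdFinEquiv (i, j)).modNat = j := by
    have := finProdFinEquiv.symm_apply_apply (i, j)
    exact Prod.mk.inj this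
  rw [h2.1, h2.2, mul_ite, mul_zero]
  refine if_congr Iff.rfl ?_ rfl
  rw [finProdFinEquiv_apply_val, pow_add, pow_mul, mul_comm]
  norm_num

end ThreeCNF

/-- The place values of the nonzero octal digits: `octalWeight (7 * i + d) = 8 ^ i * (d + 1)`. -/
def octalWeight (u : ℕ) : ℕ := 8 ^ (u / 7) * (u % 7 + 1)

theorem octalWeight_apply (i : ℕ) (d : Fin 7) : octalWeight (7 * i + d) = 8 ^ i * (d + 1) := by
  rw [octalWeight, Nat.mul_add_div (by norm_num), Nat.div_eq_of_lt d.2, Nat.mul_add_mod,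
    Nat.mod_eq_of_lt d.2, add_zero]

namespace ThreeCNF

variable (φ : ThreeCNF)

def literalFamily (v : Fin φ.numVars) (d : Fin 2) : ℕ := φ.literalWeight (2 * v + d)

def clauseFamily (i : Fin φ.numClauses) (d : Fin 7) : ℕ := octalWeight (7 * i + d)

/-- Octal digits are unique and below 8, so a common element forces every truth pattern to be one of
the digits 1 to 7, that is, every clause to be true. -/
theorem satisfiable_iff :
    φ.Satisfiable ↔ (family φ.literalFamily ∩ family φ.clauseFamily).Nonempty := by
  constructor
  · rintro ⟨τ, hτ⟩
    set σ : Fin φ.numVars → Fin 2 := fun v => ⟨(τ v).toNat, Bool.toNat_lt _⟩ with hσ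
    have hne : ∀ i, φ.truthPattern σ i ≠ 0 := by
      intro i
      obtain ⟨j, hj⟩ := hτ i
      exact (truthPattern_ne_zero_iff σ i).2 ⟨j, by simp [hσ, hj]⟩
    refine ⟨∑ i : Fin φ.numClauses, 8 ^ (i : ℕ) * φ.truthPattern σ i,
      ⟨σ, (sum_literalWeight σ).symm⟩,
      -- Option `d` stands for the octal digit `d + 1`.
      fun i => ⟨φ.truthPattern σ i - 1, by have := truthPattern_lt σ i; omega⟩, ?_⟩
    refine Finset.sum_congr rfl fun i _ => ?_
    rw [clauseFamily, octalWeight_apply]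
    simp only
    rw [Nat.sub_add_cancel (Nat.one_le_iff_ne_zero.2 (hne i))]
  · rintro ⟨x, ⟨σ, rfl⟩, ρ, h⟩
    have h' := (sum_literalWeight σ).symm.trans h
    simp only [clauseFamily, octalWeight_apply] at h'
    have := sum_octal_injective _ _ _ (truthPattern_lt σ) (fun i => by omega) h'
    refine ⟨fun v => decide ((σ v : ℕ) = 1), fun i => ?_⟩
    have hi : φ.truthPattern σ i ≠ 0 := by rw [congrFun this i]; omega
    obtain ⟨j, hj⟩ := (truthPattern_ne_zero_iff σ i).1 hi
    refine ⟨j, ?_⟩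
    cases hb : (φ.clause i j).2 <;> simp [hb] at hj ⊢ <;> simp [hj]

theorem literalFamily_lt {x : ℕ} (hx : x ∈ family φ.literalFamily) :
    x < 2 ^ (3 * φ.numClauses) := by
  obtain ⟨σ, rfl⟩ := hx
  rw [pow_mul]
  exact (sum_literalWeight σ).trans_lt (sum_octal_lt _ _ (truthPattern_lt σ))

theorem clauseFamily_lt {x : ℕ} (hx : x ∈ family φ.clauseFamily) :
    x < 2 ^ (3 * φ.numClauses) := by
  obtain ⟨ρ, rfl⟩ := hx
  simp only [clauseFamily, octalWeight_apply]
  rw [pow_mul]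
  exact sum_octal_lt _ _ fun i => by omega

end ThreeCNF

/-! ### Choice of the prime and the size bound. -/

/-- The admissible values for the number `q` of the construction. -/
def IsAdmissible (r N q : ℕ) : Prop := q.Prime ∧ 2 * N ≤ q * (q - 1) * Nat.log r q

/-- Minimality serves twice: trial search finds this value, and smaller primes being inadmissible
bounds it above. -/
noncomputable def planeOrder (r N : ℕ) : ℕ := sInf {q | IsAdmissible r N q}

theorem exists_isAdmissible {r : ℕ} (N : ℕ) (hr : 2 ≤ r) (hr7 : r ≤ 7) :
    ∃ q ≤ 2 * N + 14, IsAdmissible r N q := by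
  -- The offset 7 ensures `q > r`, so that the logarithm is at least 1.
  obtain ⟨q, hq, h1, h2⟩ := Nat.exists_prime_lt_and_le_two_mul (N + 7) (by omega)
  refine ⟨q, by omega, hq, ?_⟩
  have h3 : 1 ≤ Nat.log r q := Nat.log_pos hr (by omega)
  have h4 : 2 * N ≤ q * (q - 1) := by
    obtain ⟨p, rfl⟩ : ∃ p, q = p + 1 := ⟨q - 1, by omega⟩
    rw [Nat.add_sub_cancel]
    nlinarith
  nlinarith

theorem isAdmissible_planeOrder {r : ℕ} (N : ℕ) (hr : 2 ≤ r) (hr7 : r ≤ 7) :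
    IsAdmissible r N (planeOrder r N) := by
  obtain ⟨q, _, hq⟩ := exists_isAdmissible N hr hr7
  exact Nat.sInf_mem (s := {q | IsAdmissible r N q}) ⟨q, hq⟩

theorem planeOrder_le {r : ℕ} (N : ℕ) (hr : 2 ≤ r) (hr7 : r ≤ 7) :
    planeOrder r N ≤ 2 * N + 14 := by
  obtain ⟨q, hle, hq⟩ := exists_isAdmissible N hr hr7
  exact (Nat.sInf_le (s := {q | IsAdmissible r N q}) hq).trans hle

theorem not_isAdmissible_of_lt {r N p : ℕ} (hp : p < planeOrder r N) : ¬ IsAdmissible r N p :=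
  Nat.notMem_of_lt_sInf hp

/-- Bertrand gives a prime `p < q ≤ 2 p`. It is inadmissible, so `p (p - 1) Nat.log r p < 2 N`.
Unless `q` is tiny or `q ^ 4 ≤ N`, `log N` is comparable to `log p`. -/
theorem planeOrder_sq_mul_log_le {r : ℕ} (N : ℕ) (hr : 2 ≤ r) (hr7 : r ≤ 7) (hN : 2 ≤ N) :
    (planeOrder r N : ℝ) ^ 2 * Real.log N ≤ 10000 * N := by
  set q := planeOrder r N with hq
  have hN0 : (0 : ℝ) < N := by positivity
  have hlogN : Real.log N ≤ N := (Real.log_le_sub_one_of_pos hN0).trans (by linarith)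
  have hlogN0 : 0 ≤ Real.log N := Real.log_natCast_nonneg N
  by_cases hsmall : q ≤ 14
  · have : (q : ℝ) ≤ 14 := by exact_mod_cast hsmall
    have : (q : ℝ) ^ 2 ≤ 14 ^ 2 := by gcongr
    nlinarith
  by_cases hlow : q ^ 4 ≤ N
  · have h1 : ((q : ℝ) ^ 2) ≤ √N := by
      apply Real.le_sqrt_of_sq_le
      rw [← pow_mul]
      exact_mod_cast hlow
    have h2 : Real.log N ≤ 2 * √N := by
      have h3 : Real.log √N ≤ √N :=
        (Real.log_le_sub_one_of_pos (Real.sqrt_pos.2 hN0)).trans (by linarith)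
      rw [Real.log_sqrt hN0.le] at h3
      linarith
    calc (q : ℝ) ^ 2 * Real.log N ≤ √N * (2 * √N) := by gcongr
      _ = 2 * N := by rw [mul_left_comm, Real.mul_self_sqrt hN0.le]
      _ ≤ _ := by linarith
  obtain ⟨p, hp, h1, h2⟩ := Nat.exists_prime_lt_and_le_two_mul ((q - 1) / 2) (by omega)
  have hp7 : 7 ≤ p := by omega
  have hpr : 1 ≤ Nat.log r p := Nat.log_pos hr (by omega)
  have hnot := not_isAdmissible_of_lt (r := r) (N := N) (p := p) (by omega)
  have hlt : p * (p - 1) * Nat.log r p < 2 * N := by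
    by_contra! h
    exact hnot ⟨hp, h⟩
  -- From `p ≤ r ^ (L + 1)` with `L ≥ 1` and the crude bound `log r ≤ 7`.
  have hlogp : Real.log p ≤ 14 * Nat.log r p := by
    have h3 : (p : ℝ) ≤ (r : ℝ) ^ (Nat.log r p + 1) := by
      exact_mod_cast (Nat.lt_pow_succ_log_self (by omega) p).le
    have h4 := Real.log_le_log (by positivity) h3
    rw [Real.log_pow] at h4
    have h5 : Real.log r ≤ 7 := by
      have : (r : ℝ) ≤ 7 := by exact_mod_cast hr7
      have h0 : (0 : ℝ) < r := by positivity
      exact (Real.log_le_sub_one_of_pos h0).trans (by linarith)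
    have h6 : (1 : ℝ) ≤ Nat.log r p := by exact_mod_cast hpr
    push_cast at h4
    have h7 : ((Nat.log r p : ℝ) + 1) * Real.log r ≤ ((Nat.log r p : ℝ) + 1) * 7 := by gcongr
    linarith
  -- Here `N < q ^ 4` and `q ≤ p ^ 2`, so `N ≤ p ^ 8`.
  have hNlog : Real.log N ≤ 8 * Real.log p := by
    have h3 : (N : ℝ) ≤ ((p : ℝ) ^ 2) ^ 4 := by
      have : N ≤ (p ^ 2) ^ 4 := by
        have : q ≤ p ^ 2 := by nlinarith [(by omega : q ≤ 2 * p)]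
        exact (not_le.1 hlow).le.trans (Nat.pow_le_pow_left this 4)
      exact_mod_cast this
    have h4 := Real.log_le_log hN0 h3
    rw [← pow_mul, Real.log_pow] at h4
    push_cast at h4
    linarith
  have hqp : (q : ℝ) ≤ 2 * p := by exact_mod_cast (by omega : q ≤ 2 * p)
  have hpp : (p : ℝ) ^ 2 * Nat.log r p ≤ 4 * N := by
    have : p ^ 2 * Nat.log r p ≤ 4 * N := by
      obtain ⟨s, rfl⟩ : ∃ s, p = s + 1 := ⟨p - 1, by omega⟩
      rw [Nat.add_sub_cancel] at hlt
      have : (s + 1) ^ 2 ≤ 2 * ((s + 1) * s) := by nlinarith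
      nlinarith
    exact_mod_cast this
  calc (q : ℝ) ^ 2 * Real.log N ≤ (2 * (p : ℝ)) ^ 2 * (8 * (14 * (Nat.log r p : ℝ))) := by
        gcongr
        linarith
    _ = 448 * ((p : ℝ) ^ 2 * (Nat.log r p : ℝ)) := by ring
    _ ≤ 10000 * (N : ℝ) := by linarith

theorem exists_numVertices_le {r : ℕ} (hr : 2 ≤ r) (hr7 : r ≤ 7) (N : ℕ) :
    (2 ≤ N → ((2 * (planeOrder r N * planeOrder r N) : ℕ) : ℝ) ≤ 20000 * (N / Real.log N)) ∧
      (N < 2 → ((2 * (planeOrder r N * planeOrder r N) : ℕ) : ℝ) ≤ 20000) := by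
  constructor
  · intro hN
    have hlog : 0 < Real.log N := Real.log_pos (by exact_mod_cast hN)
    rw [← mul_div_assoc, le_div_iff₀ hlog]
    have := planeOrder_sq_mul_log_le N hr hr7 hN
    push_cast
    linarith
  · intro hN
    have := planeOrder_le N hr hr7
    have h16 : planeOrder r N ≤ 16 := by omega
    have : 2 * (planeOrder r N * planeOrder r N) ≤ 20000 := by nlinarith
    exact_mod_cast this

/-! ### The reduction and its correctness. -/

/-- The reduction. -/
noncomputable def reduction (φ : ThreeCNF) : CommonMatchingWeight where
  G₁ := familyGraph 2 φ.numVars (planeOrder 2 φ.numVars) φ.literalWeight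
  G₂ := familyGraph 7 φ.numClauses (planeOrder 7 φ.numClauses) octalWeight

theorem reduction_matchingWeights (φ : ThreeCNF) :
    (reduction φ).G₁.matchingWeights = family φ.literalFamily ∧
      (reduction φ).G₂.matchingWeights = family φ.clauseFamily := by
  obtain ⟨h1, h2⟩ := isAdmissible_planeOrder φ.numVars (le_refl 2) (by norm_num)
  obtain ⟨h3, h4⟩ := isAdmissible_planeOrder φ.numClauses (by norm_num : 2 ≤ 7) le_rfl
  exact ⟨matchingWeights_familyGraph _ (by norm_num) h1 h2,
    matchingWeights_familyGraph _ (by norm_num) h3 h4⟩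

theorem reduction_isYes_iff (φ : ThreeCNF) : φ.Satisfiable ↔ (reduction φ).IsYes := by
  obtain ⟨h1, h2⟩ := reduction_matchingWeights φ
  rw [φ.satisfiable_iff, ← h1, ← h2]
  constructor
  · rintro ⟨x, ⟨M₁, hM₁, e₁⟩, M₂, hM₂, e₂⟩
    exact ⟨M₁, M₂, hM₁, hM₂, e₁.trans e₂.symm⟩
  · rintro ⟨M₁, M₂, hM₁, hM₂, e⟩
    exact ⟨_, ⟨M₁, hM₁, rfl⟩, M₂, hM₂, e.symm⟩

/-! ### A program logic with costs. -/

namespace RAM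

instance : Add Term := ⟨.arith .add⟩
instance : Sub Term := ⟨.arith .sub⟩
instance : Mul Term := ⟨.arith .mul⟩
instance : Div Term := ⟨.arith .div⟩

/-- The scalar variable kept in cell `0` of the array `a`. -/
abbrev var (a : ℕ) : Term := .read a (.const 0)

namespace Term

variable (s : Store) (x y : Term)

@[simp] theorem eval_add : (x + y).eval s = x.eval s + y.eval s := rfl
@[simp] theorem eval_sub : (x - y).eval s = x.eval s - y.eval s := rfl
@[simp] theorem eval_mul : (x * y).eval s = x.eval s * y.eval s := rfl
@[simp] theorem eval_div : (x / y).eval s = x.eval s / y.eval s := rfl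
@[simp] theorem eval_read (a : ℕ) : (Term.read a x).eval s = s a (x.eval s) := rfl
@[simp] theorem eval_const (c : ℕ) : (Term.const c).eval s = c := rfl

/-- The value of a term on a memory with entries at most `M` is at most `(M + 2) ^ x.degree`. -/
def degree : Term → ℕ
  | .const c => c + 1
  | .read _ _ => 1
  | .arith _ x y => x.degree + y.degree

/-- The cost of a term, in multiples of the bit length of the memory entries. -/
def weight : Term → ℕ
  | .const c => c + 1
  | .read _ i => i.weight + 2
  | .arith o x y => x.weight + y.weight + ((Term.arith o x y).degree + 1)

end Term

theorem Store.set_apply (s : Store) (a i v b j : ℕ) :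
    s.set a i v b j = if b = a ∧ j = i then v else s b j := by
  unfold Store.set
  by_cases hb : b = a
  · subst hb
    by_cases hj : j = i <;> simp [hj]
  · simp [hb]

/-- All memory entries are at most `M`. -/
def Store.Bounded (M : ℕ) (s : Store) : Prop := ∀ a i, s a i ≤ M

variable {M : ℕ} {s : Store}

theorem Term.one_le_degree (x : Term) : 1 ≤ x.degree := by
  induction x with
  | const c => simp [degree]
  | read a i _ => simp [degree]
  | arith o x y hx hy => simp only [degree]; omega

theorem ArithOp.apply_le_mul (o : ArithOp) {x y X Y : ℕ} (hX : 2 ≤ X) (hY : 2 ≤ Y) (hx : x ≤ X)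
    (hy : y ≤ Y) : o.apply x y ≤ X * Y := by
  cases o with
  | add => simp only [apply]; nlinarith
  | sub => simp only [apply]; exact (Nat.sub_le _ _).trans (by nlinarith)
  | mul => exact Nat.mul_le_mul hx hy
  | div => simp only [apply]; exact (Nat.div_le_self _ _).trans (by nlinarith)

theorem Term.eval_le (hs : s.Bounded M) (x : Term) : x.eval s ≤ (M + 2) ^ x.degree := by
  have two_le : ∀ x : Term, 2 ≤ (M + 2) ^ x.degree := fun x =>
    (by omega : 2 ≤ M + 2).trans (Nat.le_self_pow (by have := x.one_le_degree; omega) _)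
  induction x with
  | const c =>
    exact (Nat.lt_pow_self (by omega : 1 < M + 2)).le.trans
      (Nat.pow_le_pow_right (by omega) (Nat.le_succ c))
  | read a i _ => simp only [eval, degree, pow_one]; exact (hs _ _).trans (by omega)
  | arith o x y hx hy =>
    simp only [eval, degree, pow_add]
    exact o.apply_le_mul (two_le x) (two_le y) hx hy

theorem size_le_of_le_pow {v d : ℕ} (h : v ≤ (M + 2) ^ d) : v.size ≤ d * (M.size + 2) + 1 := by
  have h1 : M + 2 ≤ 2 ^ (M.size + 2) := by
    have := Nat.lt_size_self M
    have h2 : 1 ≤ 2 ^ M.size := Nat.one_le_two_pow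
    rw [pow_add]
    omega
  refine Nat.size_le.2 (h.trans_lt ?_)
  calc (M + 2) ^ d ≤ (2 ^ (M.size + 2)) ^ d := Nat.pow_le_pow_left h1 d
    _ = 2 ^ (d * (M.size + 2)) := by rw [← pow_mul, mul_comm]
    _ < _ := Nat.pow_lt_pow_right (by norm_num) (Nat.lt_succ_self _)

theorem Term.cost_le (hs : s.Bounded M) (x : Term) : x.cost s ≤ x.weight * (M.size + 2) := by
  induction x with
  | const c =>
    simp only [cost, weight]
    have : c.size ≤ c := Nat.size_le.2 Nat.lt_two_pow_self
    nlinarith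
  | read a i hi =>
    simp only [cost, weight]
    have := Nat.size_le_size (hs a (i.eval s))
    nlinarith
  | arith o x y hx hy =>
    have := size_le_of_le_pow ((Term.arith o x y).eval_le hs)
    simp only [eval] at this
    simp only [cost, weight]
    nlinarith

namespace Program

/-- The arrays written by a program. -/
def Writes : Program → ℕ → Prop
  | .skip, _ => False
  | .write a _ _, b => b = a
  | .seq p q, b => p.Writes b ∨ q.Writes b
  | .ifThenElse _ p q, b => p.Writes b ∨ q.Writes b
  | .whileDo _ p, b => p.Writes b

end Program

theorem Exec.eq_of_not_writes {p : Program} {s s' : Store} {t : ℕ} (h : Exec p s t s') (b : ℕ)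
    (hb : ¬ p.Writes b) : s' b = s b := by
  induction h with
  | skip s => rfl
  | write s a i v => exact Function.update_of_ne hb _ _
  | seq _ _ h1 h2 =>
    simp only [Program.Writes, not_or] at hb
    rw [h2 hb.2, h1 hb.1]
  | ifTrue _ _ h1 => exact h1 fun h => hb (Or.inl h)
  | ifFalse _ _ h1 => exact h1 fun h => hb (Or.inr h)
  | whileTrue _ _ _ h1 h2 => rw [h2 hb, h1 hb]
  | whileFalse _ => rfl

/-- The program `p`, started in `s`, halts within `T` units of cost in a state with property `Q`;
one unit is the bit length of the bound `M` for the memory entries, plus two. -/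
def Halts (M : ℕ) (p : Program) (s : Store) (T : ℕ) (Q : Store → Prop) : Prop :=
  ∃ t s', Exec p s t s' ∧ t ≤ T * (M.size + 2) ∧ s'.Bounded M ∧ Q s'

namespace Halts

variable {p q : Program} {T T' : ℕ} {Q Q' : Store → Prop}

theorem mono (h : Halts M p s T Q) (hT : T ≤ T') (hQ : ∀ s', s'.Bounded M → Q s' → Q' s') :
    Halts M p s T' Q' := by
  obtain ⟨t, s', h1, h2, h3, h4⟩ := h
  exact ⟨t, s', h1, h2.trans (Nat.mul_le_mul_right _ hT), h3, hQ s' h3 h4⟩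

theorem frame (h : Halts M p s T Q) :
    Halts M p s T fun s' => Q s' ∧ ∀ b, ¬ p.Writes b → s' b = s b := by
  obtain ⟨t, s', h1, h2, h3, h4⟩ := h
  exact ⟨t, s', h1, h2, h3, h4, fun b hb => h1.eq_of_not_writes b hb⟩

/-- The continuation learns that unwritten arrays are unchanged, so intermediate assertions need
only mention what was modified. -/
theorem seq (h : Halts M p s T Q)
    (h' : ∀ s', s'.Bounded M → Q s' → (∀ b, ¬ p.Writes b → s' b = s b) → Halts M q s' T' Q') :
    Halts M (.seq p q) s (T + T' + 1) Q' := by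
  obtain ⟨t, s', h1, h2, h3, h4, h5⟩ := h.frame
  obtain ⟨t', s'', k1, k2, k3, k4⟩ := h' s' h3 h4 h5
  refine ⟨_, s'', .seq h1 k1, ?_, k3, k4⟩
  rw [add_mul, add_mul]
  omega

end Halts

/-- The cost of a loop-free program, in the units of `Halts`. -/
def Program.weight : Program → ℕ
  | .skip => 1
  | .write _ i v => i.weight + v.weight + 1
  | .seq p q => p.weight + q.weight + 1
  | .ifThenElse e p q => e.weight + p.weight + q.weight + 1
  | .whileDo _ _ => 0

/-- The weakest precondition of a loop-free program. -/
def Program.wp (M : ℕ) : Program → (Store → Prop) → Store → Prop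
  | .skip, Q, s => Q s
  | .write a i v, Q, s => v.eval s ≤ M ∧ Q (s.set a (i.eval s) (v.eval s))
  | .seq p q, Q, s => p.wp M (q.wp M Q) s
  | .ifThenElse e p q, Q, s => (e.eval s ≠ 0 → p.wp M Q s) ∧ (e.eval s = 0 → q.wp M Q s)
  | .whileDo _ _, _, _ => False

theorem Store.Bounded.set (hs : s.Bounded M) {a i v : ℕ} (hv : v ≤ M) :
    (s.set a i v).Bounded M := by
  intro b j
  rw [Store.set_apply]
  split_ifs
  exacts [hv, hs b j]

/-- Reduces loop-free code to a computation with `Program.wp`, whose assignments also demand that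
the written value stays below `M`. -/
theorem Program.halts_of_wp {p : Program} {Q : Store → Prop} (hs : s.Bounded M)
    (h : p.wp M Q s) : Halts M p s p.weight Q := by
  induction p generalizing s Q with
  | skip => exact ⟨1, s, .skip s, by simp [weight], hs, h⟩
  | write a i v =>
    refine ⟨_, _, .write s a i v, ?_, hs.set h.1, h.2⟩
    have h1 := i.cost_le hs
    have h2 := v.cost_le hs
    simp only [weight]
    rw [add_mul, add_mul]
    omega
  | seq p q hp hq => exact (hp hs h).seq fun s' hs' h' _ => hq hs' h'
  | ifThenElse e p q hp hq =>
    have h1 := e.cost_le hs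
    by_cases he : e.eval s = 0
    · obtain ⟨t, s', k1, k2, k3, k4⟩ := hq hs (h.2 he)
      refine ⟨_, s', .ifFalse he k1, ?_, k3, k4⟩
      simp only [weight]
      rw [add_mul, add_mul, add_mul]
      omega
    · obtain ⟨t, s', k1, k2, k3, k4⟩ := hp hs (h.1 he)
      refine ⟨_, s', .ifTrue he k1, ?_, k3, k4⟩
      simp only [weight]
      rw [add_mul, add_mul, add_mul]
      omega
  | whileDo e p _ => exact h.elim

/-- A loop that is left after exactly `K` rounds, with the invariant `I`. -/
theorem Halts.whileDo {e : Term} {p : Program} {T : ℕ} (I : ℕ → Store → Prop) (K : ℕ)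
    (hs : s.Bounded M) (h0 : I 0 s)
    (he : ∀ k ≤ K, ∀ s', I k s' → (∀ b, ¬ p.Writes b → s' b = s b) → (e.eval s' ≠ 0 ↔ k < K))
    (hp : ∀ k < K, ∀ s', s'.Bounded M → I k s' → (∀ b, ¬ p.Writes b → s' b = s b) →
      Halts M p s' T (I (k + 1))) :
    Halts M (.whileDo e p) s ((K + 1) * (T + e.weight + 1)) (I K) := by
  -- Induction on the number `j` of remaining rounds.
  suffices H : ∀ j k, k + j = K → ∀ s', s'.Bounded M → I k s' →
      (∀ b, ¬ p.Writes b → s' b = s b) →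
      Halts M (.whileDo e p) s' ((j + 1) * (T + e.weight + 1)) (I K) from
    H K 0 (by omega) s hs h0 fun _ _ => rfl
  intro j
  induction j with
  | zero =>
    intro k hk s' hs' hI hf
    have h1 : e.eval s' = 0 := by
      by_contra hne
      have := (he k (by omega) s' hI hf).1 hne
      omega
    have h2 := e.cost_le hs'
    obtain rfl : k = K := by omega
    refine ⟨_, s', .whileFalse h1, ?_, hs', hI⟩
    nlinarith
  | succ j ih =>
    intro k hk s' hs' hI hf
    have h1 := (he k (by omega) s' hI hf).2 (by omega)
    have h2 := e.cost_le hs'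
    obtain ⟨t, s₁, k1, k2, k3, k4, k5⟩ := (hp k (by omega) s' hs' hI hf).frame
    obtain ⟨t', s₂, l1, l2, l3, l4⟩ := ih (k + 1) (by omega) s₁ k3 k4
      fun b hb => (k5 b hb).trans (hf b hb)
    refine ⟨_, s₂, .whileTrue h1 k1 l1, ?_, l3, l4⟩
    nlinarith

end RAM

/-! ### Searching for the prime. -/

namespace RAM

namespace Term

/-- The remainder of a division. -/
def mod (x y : Term) : Term := x - x / y * y

@[simp] theorem eval_mod (s : Store) (x y : Term) : (x.mod y).eval s = x.eval s % y.eval s := by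
  simp [mod, Nat.mod_eq_sub_div_mul]

end Term

/-- Assignment to a scalar variable. -/
abbrev Program.assign (a : ℕ) (v : Term) : Program := .write a (.const 0) v

/-- Sequential composition of a list of programs. -/
def Program.block : List Program → Program
  | [] => .skip
  | [p] => p
  | p :: l => .seq p (block l)

open Term Program

/-- Variables: `3` holds `N`, `4` holds `r`, `5` holds `q`, `6` is nonzero if `q` is admissible,
`7` and `8` serve to count the proper divisors of `q`, `9` and `10` to compute `Nat.log r q`. -/
def countDivisorsBody : Program := block
  [assign 8 (var 8 + (const 1 - (var 5).mod (var 7))), assign 7 (var 7 + const 1)]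

def logBody : Program := block [assign 9 (var 9 + const 1), assign 10 (var 10 * var 4)]

def searchInit : Program := block
  [assign 5 (var 5 + const 1), assign 7 (const 0), assign 8 (const 0)]

def logInit : Program := block [assign 9 (const 0), assign 10 (var 4)]

def testAdmissible : Program :=
  assign 6 ((const 2 - var 8) * var 8 *
    (var 5 * (var 5 - const 1) * var 9 + const 1 - const 2 * var 3))

def searchBody : Program := block
  [searchInit, .whileDo (var 5 - var 7) countDivisorsBody, logInit,
    .whileDo (var 5 + const 1 - var 10) logBody, testAdmissible]

def search : Program := block
  [block [assign 5 (const 0), assign 6 (const 0)], .whileDo (const 1 - var 6) searchBody]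

/-- With truncated subtraction, `(2 - c) * c` is nonzero only for `c = 1`, which for the number of
proper divisors means primality; `A + 1 - 2 * N` is nonzero iff `2 * N ≤ A`. -/
theorem isAdmissible_iff (r N q : ℕ) (hq : 0 < q) :
    (2 - ((Finset.range q).filter (· ∣ q)).card) * ((Finset.range q).filter (· ∣ q)).card
      * (q * (q - 1) * Nat.log r q + 1 - 2 * N) ≠ 0 ↔ IsAdmissible r N q := by
  have h : (Finset.range q).filter (· ∣ q) = q.properDivisors := by
    ext d
    simp only [Finset.mem_filter, Finset.mem_range, Nat.mem_properDivisors]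
    exact and_comm
  have hp : q.properDivisors.card = 1 ↔ q.Prime := by
    rw [← Nat.properDivisors_eq_singleton_one_iff_prime, Finset.card_eq_one]
    constructor
    · rintro ⟨a, ha⟩
      have hmem : a ∈ q.properDivisors := by rw [ha]; simp
      have h1 : 1 ∈ q.properDivisors := by
        rw [Nat.mem_properDivisors] at hmem ⊢
        refine ⟨one_dvd _, ?_⟩
        have := Nat.pos_of_dvd_of_pos hmem.1 hq
        omega
      rw [ha, Finset.mem_singleton] at h1
      rw [ha, h1]
    · intro h; exact ⟨1, h⟩
  rw [IsAdmissible, ← hp, h, mul_ne_zero_iff, mul_ne_zero_iff]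
  omega

variable {M : ℕ}

theorem halts_countDivisors {s : Store} {q : ℕ} (hs : s.Bounded M) (hM : q + 1 ≤ M)
    (h5 : s 5 0 = q) (h7 : s 7 0 = 0) (h8 : s 8 0 = 0) :
    Halts M (.whileDo (var 5 - var 7) countDivisorsBody) s ((q + 1) * 100)
      fun s' => s' 8 0 = ((Finset.range q).filter (· ∣ q)).card := by
  refine (Halts.whileDo (T := countDivisorsBody.weight) (fun k s' => s' 7 0 = k ∧
    s' 8 0 = ((Finset.range k).filter (· ∣ q)).card) q hs ?_ ?_ ?_).mono
      (Nat.mul_le_mul_left _ (by decide)) fun s' _ h => h.2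
  · simp [h7, h8]
  · rintro k hk s' ⟨e7, e8⟩ hf
    have e5 : s' 5 0 = q := by
      rw [hf 5 (by simp [countDivisorsBody, block, Writes]), h5]
    simp only [eval_sub, eval_read, eval_const, e5, e7]
    omega
  · rintro k hk s' hs' ⟨e7, e8⟩ hf
    have e5 : s' 5 0 = q := by
      rw [hf 5 (by simp [countDivisorsBody, block, Writes]), h5]
    -- Also correct at `k = 0`: there `q % 0 = q ≠ 0`, and 0 does not divide `q`.
    have hcard : ((Finset.range (k + 1)).filter (· ∣ q)).card =
        ((Finset.range k).filter (· ∣ q)).card + (1 - q % k) := by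
      rw [Finset.range_add_one, Finset.filter_insert]
      split_ifs with hd
      · rw [Finset.card_insert_of_notMem (by simp), Nat.mod_eq_zero_of_dvd hd]
      · have : q % k ≠ 0 := fun h => hd (Nat.dvd_of_mod_eq_zero h)
        omega
    have hle := (Finset.card_filter_le (Finset.range (k + 1)) (· ∣ q))
    rw [Finset.card_range] at hle
    refine halts_of_wp hs' ?_
    simp only [countDivisorsBody, block, wp, eval_add, eval_sub, eval_mod, eval_read, eval_const,
      Store.set_apply, e5, e7, e8]
    simp only [← hcard]
    refine ⟨by omega, ?_, ?_⟩ <;> simp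
    omega

theorem halts_log {s : Store} {q r : ℕ} (hs : s.Bounded M) (hq : 0 < q) (hr : 1 < r)
    (hM : q * r + 1 ≤ M) (h5 : s 5 0 = q) (h4 : s 4 0 = r) (h9 : s 9 0 = 0) (h10 : s 10 0 = r) :
    Halts M (.whileDo (var 5 + const 1 - var 10) logBody) s ((Nat.log r q + 1) * 100)
      fun s' => s' 9 0 = Nat.log r q := by
  -- Cell `10` is one power ahead, so the loop stops at the first `k` with `r ^ (k + 1) > q`.
  refine (Halts.whileDo (T := logBody.weight) (fun k s' => s' 9 0 = k ∧
    s' 10 0 = r ^ (k + 1)) (Nat.log r q) hs ?_ ?_ ?_).mono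
      (Nat.mul_le_mul_left _ (by decide)) fun s' _ h => h.1
  · simp [h9, h10]
  · rintro k hk s' ⟨e9, e10⟩ hf
    have e5 : s' 5 0 = q := by
      rw [hf 5 (by simp [logBody, block, Writes]), h5]
    have := Nat.le_log_iff_pow_le hr hq.ne' (x := k + 1)
    simp only [eval_sub, eval_add, eval_read, eval_const, e5, e10]
    omega
  · rintro k hk s' hs' ⟨e9, e10⟩ hf
    have e4 : s' 4 0 = r := by
      rw [hf 4 (by simp [logBody, block, Writes]), h4]
    have hle : r ^ (k + 1) ≤ q := (Nat.le_log_iff_pow_le hr hq.ne').1 hk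
    have hle' : r ^ (k + 1) * r ≤ q * r := Nat.mul_le_mul_right _ hle
    have hlt := Nat.lt_pow_self hr (n := k + 1)
    have : q ≤ q * r := Nat.le_mul_of_pos_right _ (by omega)
    refine halts_of_wp hs' ?_
    simp only [logBody, block, wp, eval_add, eval_mul, eval_read, eval_const,
      Store.set_apply, e4, e9, e10]
    have hpow : r ^ (k + 1 + 1) = r ^ (k + 1) * r := pow_succ _ _
    simp [hpow]
    omega

theorem halts_searchBody {s : Store} {r N k Y : ℕ} (hs : s.Bounded M) (hr : 2 ≤ r) (hr7 : r ≤ 7)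
    (hk : k + 1 ≤ Y) (hY : 14 ≤ Y) (hM : Y ^ 4 ≤ M) (h3 : s 3 0 = N) (h4 : s 4 0 = r)
    (h5 : s 5 0 = k) :
    Halts M searchBody s (1000 * Y) fun s' => s' 5 0 = k + 1 ∧
      (s' 6 0 ≠ 0 ↔ IsAdmissible r N (k + 1)) ∧ s' 9 0 = Nat.log r (k + 1) := by
  have hY4 : 14 ^ 3 * Y ≤ Y ^ 4 := by
    rw [pow_succ]
    exact Nat.mul_le_mul_right _ (Nat.pow_le_pow_left hY 3)
  have hlog : Nat.log r (k + 1) ≤ k + 1 := Nat.log_le_self _ _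
  have hkr : (k + 1) * r ≤ Y * 7 := Nat.mul_le_mul hk hr7
  refine Halts.mono (T := searchInit.weight + ((k + 1 + 1) * 100 + (logInit.weight +
      ((Nat.log r (k + 1) + 1) * 100 + testAdmissible.weight + 1) + 1) + 1) + 1) ?_ ?_
      fun _ _ h => h
  · refine Halts.seq (Q := fun s' => s' 5 0 = k + 1 ∧ s' 7 0 = 0 ∧ s' 8 0 = 0)
      (halts_of_wp hs ?_) ?_
    · simp only [searchInit, block, wp, eval_add, eval_read, eval_const, Store.set_apply, h5]
      simp
      omega
    rintro s₁ hs₁ ⟨a5, a7, a8⟩ hf₁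
    refine (halts_countDivisors hs₁ (by omega) a5 a7 a8).seq ?_
    rintro s₂ hs₂ b8 hf₂
    have b5 : s₂ 5 0 = k + 1 := by
      rw [hf₂ 5 (by simp [countDivisorsBody, block, Writes]), a5]
    have b4 : s₂ 4 0 = r := by
      rw [hf₂ 4 (by simp [countDivisorsBody, block, Writes]),
        hf₁ 4 (by simp [searchInit, block, Writes]), h4]
    have b3 : s₂ 3 0 = N := by
      rw [hf₂ 3 (by simp [countDivisorsBody, block, Writes]),
        hf₁ 3 (by simp [searchInit, block, Writes]), h3]
    refine Halts.seq (Q := fun s' => s' 9 0 = 0 ∧ s' 10 0 = r) (halts_of_wp hs₂ ?_) ?_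
    · simp only [logInit, block, wp, eval_read, eval_const, Store.set_apply]
      simp [b4]
      omega
    rintro s₃ hs₃ ⟨c9, c10⟩ hf₃
    have c5 : s₃ 5 0 = k + 1 := by rw [hf₃ 5 (by simp [logInit, block, Writes]), b5]
    have c4 : s₃ 4 0 = r := by rw [hf₃ 4 (by simp [logInit, block, Writes]), b4]
    have c3 : s₃ 3 0 = N := by rw [hf₃ 3 (by simp [logInit, block, Writes]), b3]
    have c8 := (congrFun (hf₃ 8 (by simp [logInit, block, Writes])) 0).trans b8
    refine (halts_log hs₃ (Nat.add_one_pos k) (by omega) (by omega) c5 c4 c9 c10).seq ?_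
    rintro s₄ hs₄ d9 hf₄
    have d5 : s₄ 5 0 = k + 1 := by rw [hf₄ 5 (by simp [logBody, block, Writes]), c5]
    have d3 : s₄ 3 0 = N := by rw [hf₄ 3 (by simp [logBody, block, Writes]), c3]
    have d8 := (congrFun (hf₄ 8 (by simp [logBody, block, Writes])) 0).trans c8
    refine halts_of_wp hs₄ ?_
    have hiff := isAdmissible_iff r N (k + 1) (Nat.add_one_pos k)
    simp only [testAdmissible, block, wp, eval_add, eval_mul, eval_sub, eval_read, eval_const,
      Store.set_apply, d3, d5, d8, d9]
    refine ⟨?_, by simp, by simpa using hiff, by simp⟩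
    generalize ((Finset.range (k + 1)).filter (· ∣ k + 1)).card = c
    have hc : (2 - c) * c ≤ 1 := by
      rcases c with _ | _ | c <;> simp
    have h1 : (k + 1) * (k + 1 - 1) * Nat.log r (k + 1) ≤ Y * Y * Y :=
      Nat.mul_le_mul (Nat.mul_le_mul hk (by omega)) (by omega)
    have h2 : Y * Y * Y + 1 ≤ Y ^ 4 := by
      have : 1 ≤ Y * Y * Y := Nat.one_le_iff_ne_zero.2 (by positivity)
      calc Y * Y * Y + 1 ≤ Y * Y * Y * 2 := by omega
        _ ≤ Y * Y * Y * Y := Nat.mul_le_mul_left _ (by omega)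
        _ = Y ^ 4 := by ring
    calc _ ≤ 1 * ((k + 1) * (k + 1 - 1) * Nat.log r (k + 1) + 1) :=
          Nat.mul_le_mul hc (Nat.sub_le _ _)
      _ ≤ M := by omega
  · have : searchInit.weight + logInit.weight + testAdmissible.weight ≤ 200 := by decide
    omega

theorem halts_search {s : Store} {r N Y : ℕ} (hs : s.Bounded M) (hr : 2 ≤ r) (hr7 : r ≤ 7)
    (hY : 2 * N + 16 ≤ Y) (hM : Y ^ 4 ≤ M) (h3 : s 3 0 = N) (h4 : s 4 0 = r) :
    Halts M search s (2000 * Y ^ 2) fun s' => s' 5 0 = planeOrder r N ∧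
      s' 9 0 = Nat.log r (planeOrder r N) := by
  have hq := planeOrder_le N hr hr7
  obtain ⟨hprime, -⟩ := isAdmissible_planeOrder N hr hr7
  refine Halts.mono (T := (block [assign 5 (const 0), assign 6 (const 0)]).weight +
    (planeOrder r N + 1) * (1000 * Y + (const 1 - var 6).weight + 1) + 1) ?_ ?_ fun _ _ h => h
  · refine Halts.seq (Q := fun s' => s' 5 0 = 0 ∧ s' 6 0 = 0) (halts_of_wp hs ?_) ?_
    · simp [block, wp, Store.set_apply]
    rintro s₁ hs₁ ⟨a5, a6⟩ hf₁
    -- The initial candidate 0 is not prime, in agreement with the cleared flag; its logarithm has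
    -- not been computed, hence the guard `k ≠ 0`.
    refine (Halts.whileDo (T := 1000 * Y) (fun k s' => s' 5 0 = k ∧
      (s' 6 0 ≠ 0 ↔ IsAdmissible r N k) ∧ (k ≠ 0 → s' 9 0 = Nat.log r k)) (planeOrder r N) hs₁
      ?_ ?_ ?_).mono le_rfl ?_
    · refine ⟨a5, ?_, by simp⟩
      simp [a6, IsAdmissible, Nat.not_prime_zero]
    · rintro k hk s' ⟨e5, e6, -⟩ hf
      simp only [eval_sub, eval_read, eval_const]
      rcases hk.lt_or_eq with hlt | rfl
      · have := not_isAdmissible_of_lt hlt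
        simp only [this, iff_false, not_not] at e6
        simp [e6, hlt]
      · have := e6.2 (isAdmissible_planeOrder N hr hr7)
        omega
    · rintro k hk s' hs' ⟨e5, -, -⟩ hf
      have e3 : s' 3 0 = N := by
        rw [hf 3 (by simp [searchBody, searchInit, countDivisorsBody, logInit, logBody,
          testAdmissible, block, Writes]), hf₁ 3 (by simp [block, Writes]), h3]
      have e4 : s' 4 0 = r := by
        rw [hf 4 (by simp [searchBody, searchInit, countDivisorsBody, logInit, logBody,
          testAdmissible, block, Writes]), hf₁ 4 (by simp [block, Writes]), h4]
      exact (halts_searchBody hs' hr hr7 (by omega) (by omega) hM e3 e4 e5).mono le_rfl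
        fun _ _ h => ⟨h.1, h.2.1, fun _ => h.2.2⟩
    · rintro s' - ⟨e5, -, e9⟩
      exact ⟨e5, e9 hprime.ne_zero⟩
  · have h1 : (block [assign 5 (const 0), assign 6 (const 0)]).weight ≤ 50 := by decide
    have h2 : (const 1 - var 6).weight ≤ 50 := by decide
    calc _ ≤ 50 + Y * (1000 * Y + 50 + 1) + 1 := by gcongr; omega
      _ ≤ 2000 * Y ^ 2 := by nlinarith

end RAM

/-! ### Writing a weight matrix. -/

namespace RAM

open Term Program

/-- Further variables: `11` is the position `e` in the weight matrix, `19` and `20` its row and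
column, `12` the number of the digit, `13` the remaining digits, `14` the accumulated weight, and
`15` the last output position in use. -/
def matrixInit : Program := block
  [assign 15 (var 15 + const 1), .write 1 (var 15) (var 5 * var 5), assign 11 (const 0)]

def edgeInit : Program := block
  [assign 12 (const 0), assign 14 (const 0), assign 19 (var 11 / (var 5 * var 5)),
    assign 20 ((var 11).mod (var 5 * var 5)),
    assign 13 (((var 20).mod (var 5) + var 19 / var 5 * (var 20 / var 5 * (var 20 / var 5))
      + (var 19).mod (var 5) * (var 20 / var 5)).mod (var 5))]

def edgeBody : Program := block
  [assign 14 (var 14 + .read 2 (var 4 * (var 19 * var 9 + var 12) + (var 13).mod (var 4)) *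
      (const 1 - (var 19 * var 9 + var 12 + const 1 - var 3))),
    assign 13 (var 13 / var 4), assign 12 (var 12 + const 1)]

def edgeOutput : Program := block
  [assign 15 (var 15 + const 1), .write 1 (var 15) (var 14), assign 11 (var 11 + const 1)]

def matrixBody : Program :=
  block [edgeInit, .whileDo (var 9 - var 12) edgeBody, edgeOutput]

def matrix : Program :=
  block [matrixInit, .whileDo (var 5 * var 5 * (var 5 * var 5) - var 11) matrixBody]

variable {M : ℕ}

theorem digitWeight_le {r N B : ℕ} {F : ℕ → ℕ} (hF : ∀ c, F c ≤ B) (u d : ℕ) :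
    digitWeight r N F u d ≤ B :=
  (Nat.mul_le_mul (hF _) (Nat.sub_le 1 _)).trans (by simp)

theorem edgeWeight_le {r N q B : ℕ} {F : ℕ → ℕ} (hF : ∀ c, F c ≤ B) (i j : ℕ) :
    edgeWeight r N q F i j ≤ Nat.log r q * B := by
  refine (Finset.sum_le_card_nsmul _ _ B fun t _ => digitWeight_le hF _ _).trans ?_
  simp

theorem halts_edge {s : Store} {r N q i j B : ℕ} {F : ℕ → ℕ} (hs : s.Bounded M)
    (hF : ∀ c, F c ≤ B) (hq : 0 < q) (hM : q * B + q ≤ M) (h2 : s 2 = F) (h3 : s 3 0 = N)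
    (h4 : s 4 0 = r) (h9 : s 9 0 = Nat.log r q) (h19 : s 19 0 = i)
    (h12 : s 12 0 = 0) (h13 : s 13 0 = curveValue q i j) (h14 : s 14 0 = 0) :
    Halts M (.whileDo (var 9 - var 12) edgeBody) s ((Nat.log r q + 1) * 250)
      fun s' => s' 14 0 = edgeWeight r N q F i j := by
  have hlog : Nat.log r q ≤ q := Nat.log_le_self _ _
  have hmem : ∀ s' : Store, (∀ b, ¬ edgeBody.Writes b → s' b = s b) →
      s' 2 = F ∧ s' 3 0 = N ∧ s' 4 0 = r ∧ s' 9 0 = Nat.log r q ∧ s' 19 0 = i := by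
    intro s' hf
    rw [hf 2 (by simp [edgeBody, block, Writes]), hf 3 (by simp [edgeBody, block, Writes]),
      hf 4 (by simp [edgeBody, block, Writes]), hf 9 (by simp [edgeBody, block, Writes]),
      hf 19 (by simp [edgeBody, block, Writes])]
    exact ⟨h2, h3, h4, h9, h19⟩
  refine (Halts.whileDo (T := edgeBody.weight) (fun k s' => s' 12 0 = k ∧
    s' 13 0 = curveValue q i j / r ^ k ∧ s' 14 0 = ∑ t ∈ Finset.range k,
      digitWeight r N F (i * Nat.log r q + t) (curveValue q i j / r ^ t % r)) (Nat.log r q) hs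
    ?_ ?_ ?_).mono (Nat.mul_le_mul_left _ (by decide)) fun s' _ h => h.2.2
  · simp [h12, h13, h14]
  · rintro k hk s' ⟨e12, -, -⟩ hf
    simp only [eval_sub, eval_read, eval_const, (hmem s' hf).2.2.2.1, e12]
    omega
  · rintro k hk s' hs' ⟨e12, e13, e14⟩ hf
    obtain ⟨e2, e3, e4, e9, e19⟩ := hmem s' hf
    have hsum := Finset.sum_range_succ (fun t => digitWeight r N F (i * Nat.log r q + t)
      (curveValue q i j / r ^ t % r)) k
    have hle : ∑ t ∈ Finset.range (k + 1), digitWeight r N F (i * Nat.log r q + t)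
        (curveValue q i j / r ^ t % r) ≤ q * B := by
      refine (Finset.sum_le_card_nsmul _ _ B fun t _ => digitWeight_le hF _ _).trans ?_
      rw [Finset.card_range, smul_eq_mul]
      exact Nat.mul_le_mul_right _ (by omega)
    have hlt := curveValue_lt hq i j
    have hdiv : curveValue q i j / r ^ k / r ≤ curveValue q i j :=
      (Nat.div_le_self _ _).trans (Nat.div_le_self _ _)
    refine halts_of_wp hs' ?_
    rw [digitWeight] at hsum
    simp only [edgeBody, block, wp, eval_add, eval_sub, eval_mul, eval_div, eval_mod, eval_read,
      eval_const, Store.set_apply, e2, e3, e4, e9, e12, e13, e14, e19]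
    simp only [← hsum]
    simp only [pow_succ, ← Nat.div_div_eq_div_mul]
    simp
    omega

/-- Stated for an arbitrary last used position `P`, with earlier output preserved, so that the same
program appends the second matrix to the first. -/
theorem halts_matrix {s : Store} {r N q B P Y : ℕ} {F : ℕ → ℕ} (hs : s.Bounded M)
    (hF : ∀ c, F c ≤ B) (hq : 0 < q) (hY : 14 ≤ Y) (hqY : q + 1 ≤ Y) (hP : P ≤ Y ^ 4)
    (hM : Y ^ 5 * (B + 1) ≤ M) (h2 : s 2 = F) (h3 : s 3 0 = N)
    (h4 : s 4 0 = r) (h5 : s 5 0 = q) (h9 : s 9 0 = Nat.log r q) (h15 : s 15 0 = P) :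
    Halts M matrix s (1000 * Y ^ 5) fun s' => s' 15 0 = P + 1 + q * q * (q * q) ∧
      s' 1 (P + 1) = q * q ∧ (∀ e < q * q * (q * q),
        s' 1 (P + 2 + e) = edgeWeight r N q F (e / (q * q)) (e % (q * q))) ∧
      ∀ x ≤ P, s' 1 x = s 1 x := by
  have hlog : Nat.log r q ≤ q := Nat.log_le_self _ _
  have hYM : Y ^ 5 + Y ^ 5 * B ≤ M := by rw [mul_add, mul_one] at hM; omega
  have hYpow : 14 * Y ^ 4 ≤ Y ^ 5 := by
    rw [pow_succ Y 4, mul_comm]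
    exact Nat.mul_le_mul_left _ hY
  have hY4 : Y ≤ Y ^ 4 := Nat.le_self_pow (by norm_num) Y
  have hYB : Y * B ≤ Y ^ 5 * B := Nat.mul_le_mul_right _ (by omega)
  have hqB : q * B ≤ Y * B := Nat.mul_le_mul_right _ (by omega)
  have hq2 : q * q + 1 ≤ Y ^ 2 := by nlinarith
  have hq4 : q * q * (q * q) + 1 ≤ Y ^ 4 := by
    calc q * q * (q * q) + 1 ≤ (q * q + 1) * (q * q + 1) := by nlinarith
      _ ≤ Y ^ 2 * Y ^ 2 := Nat.mul_le_mul hq2 hq2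
      _ = Y ^ 4 := by ring
  have hq24 : q * q ≤ q * q * (q * q) := Nat.le_mul_of_pos_right _ (by positivity)
  refine Halts.mono (T := matrixInit.weight + ((q * q * (q * q) + 1) * ((edgeInit.weight +
    ((Nat.log r q + 1) * 250 + edgeOutput.weight + 1) + 1) +
    (var 5 * var 5 * (var 5 * var 5) - var 11).weight + 1)) + 1) ?_ ?_ fun _ _ h => h
  · refine Halts.seq (Q := fun s' => s' 15 0 = P + 1 ∧ s' 11 0 = 0 ∧ s' 1 (P + 1) = q * q ∧
      ∀ x ≤ P, s' 1 x = s 1 x) (halts_of_wp hs ?_) ?_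
    · simp only [matrixInit, block, wp, eval_add, eval_mul, eval_read, eval_const, Store.set_apply,
        h5, h15]
      simp
      refine ⟨by omega, by omega, fun x hx h => by omega⟩
    rintro s₁ hs₁ ⟨a15, a11, a1, a1'⟩ hf₁
    refine (Halts.whileDo (fun k s' => s' 11 0 = k ∧ s' 15 0 = P + 1 + k ∧
      s' 1 (P + 1) = q * q ∧ (∀ e < k,
        s' 1 (P + 2 + e) = edgeWeight r N q F (e / (q * q)) (e % (q * q))) ∧
      ∀ x ≤ P, s' 1 x = s 1 x) (q * q * (q * q)) hs₁ ?_ ?_ ?_).mono le_rfl fun s' _ h => h.2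
    · exact ⟨a11, a15, a1, by simp, a1'⟩
    · rintro k hk s' ⟨e11, -⟩ hf
      have e5 : s' 5 0 = q := by
        rw [hf 5 (by simp [matrixBody, edgeInit, edgeBody, edgeOutput, block, Writes]),
          hf₁ 5 (by simp [matrixInit, block, Writes]), h5]
      simp only [eval_sub, eval_mul, eval_read, eval_const, e11, e5]
      omega
    · rintro k hk s' hs' ⟨e11, e15, e1, e1', e1''⟩ hf
      have hmem : ∀ b, b = 2 ∨ b = 3 ∨ b = 4 ∨ b = 5 ∨ b = 9 → s' b = s b := by
        intro b hb
        rw [hf b (by rcases hb with rfl | rfl | rfl | rfl | rfl <;>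
            simp [matrixBody, edgeInit, edgeBody, edgeOutput, block, Writes]),
          hf₁ b (by rcases hb with rfl | rfl | rfl | rfl | rfl <;>
            simp [matrixInit, block, Writes])]
      have e2 := (hmem 2 (by simp)).trans h2
      have e3 := (congrFun (hmem 3 (by simp)) 0).trans h3
      have e4 := (congrFun (hmem 4 (by simp)) 0).trans h4
      have e5 := (congrFun (hmem 5 (by simp)) 0).trans h5
      have e9 := (congrFun (hmem 9 (by simp)) 0).trans h9
      have hi : k / (q * q) ≤ k := Nat.div_le_self _ _
      have hj : k % (q * q) ≤ k := Nat.mod_le _ _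
      have hc := curveValue_lt hq (k / (q * q)) (k % (q * q))
      refine Halts.seq (Q := fun s' => s' 12 0 = 0 ∧ s' 14 0 = 0 ∧ s' 19 0 = k / (q * q) ∧
        s' 13 0 = curveValue q (k / (q * q)) (k % (q * q))) (halts_of_wp hs' ?_) ?_
      · simp only [edgeInit, block, wp, eval_add, eval_mul, eval_div, eval_mod, eval_read,
          eval_const, Store.set_apply, e5, e11, and_self, and_true, true_and,
          Nat.reduceEqDiff, reduceIte]
        rw [curveValue, sq] at hc ⊢
        omega
      rintro s₂ hs₂ ⟨b12, b14, b19, b13⟩ hf₂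
      have hmem₂ : ∀ b, b = 1 ∨ b = 2 ∨ b = 3 ∨ b = 4 ∨ b = 9 ∨ b = 11 ∨ b = 15 →
          s₂ b = s' b := by
        rintro b (rfl | rfl | rfl | rfl | rfl | rfl | rfl) <;>
          exact hf₂ _ (by simp [edgeInit, block, Writes])
      refine (halts_edge (i := k / (q * q)) (j := k % (q * q)) (N := N) hs₂ hF hq (by omega)
        ((hmem₂ 2 (by simp)).trans e2) ((congrFun (hmem₂ 3 (by simp)) 0).trans e3)
        ((congrFun (hmem₂ 4 (by simp)) 0).trans e4) ((congrFun (hmem₂ 9 (by simp)) 0).trans e9)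
        b19 b12 b13 b14).seq ?_
      rintro s₃ hs₃ c14 hf₃
      have hmem₃ : ∀ b, b = 1 ∨ b = 11 ∨ b = 15 → s₃ b = s' b := by
        intro b hb
        rw [hf₃ b (by rcases hb with rfl | rfl | rfl <;> simp [edgeBody, block, Writes])]
        exact hmem₂ b (by omega)
      have c11 := (congrFun (hmem₃ 11 (by simp)) 0).trans e11
      have c15 := (congrFun (hmem₃ 15 (by simp)) 0).trans e15
      have c1 := hmem₃ 1 (by simp)
      have hw := edgeWeight_le (r := r) (N := N) (q := q) hF (k / (q * q)) (k % (q * q))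
      have hlB : Nat.log r q * B ≤ q * B := Nat.mul_le_mul_right _ hlog
      refine halts_of_wp hs₃ ?_
      simp only [edgeOutput, block, wp, eval_add, eval_read, eval_const, Store.set_apply,
        c1, c11, c14, c15]
      refine ⟨by omega, by simp; omega, by simp; omega, by simp, by simp; omega, ?_, ?_, ?_⟩
      · simp [e1]
        omega
      · intro e he
        rcases (Nat.lt_succ_iff.1 he).lt_or_eq with hlt | rfl
        · have : ¬ P + 2 + e = P + 1 + k + 1 := by omega
          simp [this, e1' e hlt]
        · have : P + 2 + e = P + 1 + e + 1 := by omega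
          simp [this]
      · intro x hx
        have : ¬ x = P + 1 + k + 1 := by omega
        simp [this, e1'' x hx]
  · have h1 : matrixInit.weight ≤ 100 := by decide
    have h2 : edgeInit.weight ≤ 500 := by decide
    have h3 : edgeOutput.weight ≤ 100 := by decide
    have h4 : (var 5 * var 5 * (var 5 * var 5) - var 11).weight ≤ 100 := by decide
    have h5 : Y ^ 4 * Y = Y ^ 5 := by ring
    calc _ ≤ 100 + Y ^ 4 * ((500 + (Y * 250 + 100 + 1) + 1) + 100 + 1) + 1 := by
          gcongr
          omega
      _ = 250 * (Y ^ 4 * Y) + 703 * Y ^ 4 + 101 := by ring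
      _ ≤ 1000 * Y ^ 5 := by rw [h5]; omega

end RAM

/-! ### Input and output representations. -/

/-- Only the table entries below `r * N` matter. This allows stale entries of the first table to
remain beyond the end of the second. -/
theorem edgeWeight_congr {r N q : ℕ} {F F' : ℕ → ℕ} (hr : 0 < r) (h : ∀ c < r * N, F c = F' c)
    (i j : ℕ) : edgeWeight r N q F i j = edgeWeight r N q F' i j := by
  refine Finset.sum_congr rfl fun t _ => ?_
  unfold digitWeight
  set u := i * Nat.log r q + t
  have hd := Nat.mod_lt (curveValue q i j / r ^ t) hr
  by_cases hu : u < N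
  · rw [h]
    have : r * (u + 1) ≤ r * N := Nat.mul_le_mul_left _ hu
    rw [Nat.mul_add] at this
    omega
  · have : 1 - (u + 1 - N) = 0 := by omega
    rw [this, Nat.mul_zero, Nat.mul_zero]

namespace ThreeCNF

variable (φ : ThreeCNF)

theorem length_code : φ.code.length = 2 + φ.numVars + φ.numClauses * 3 := by
  simp only [code, List.length_cons, List.length_append, List.length_range, List.length_ofFn]
  omega

theorem mem_code_le {x : ℕ} (hx : x ∈ φ.code) : x ≤ 2 * φ.numVars + φ.numClauses := by
  simp only [code, List.mem_cons, List.mem_append, List.mem_range, List.mem_ofFn] at hx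
  rcases hx with rfl | hx | rfl | ⟨k, rfl⟩
  · omega
  · omega
  · omega
  · have h1 := (φ.clause k.divNat k.modNat).1.2
    have h2 := Bool.toNat_lt (φ.clause k.divNat k.modNat).2
    simp only [codeLiteral]
    omega

theorem _root_.RAM.length_le_bitSize (l : List ℕ) : l.length ≤ RAM.bitSize l := by
  induction l with
  | nil => simp
  | cons a l ih =>
    simp only [RAM.bitSize, List.map_cons, List.sum_cons, List.length_cons] at ih ⊢
    omega

theorem input_numVars : RAM.input φ.code 0 1 = φ.numVars := by
  simp [RAM.input, code]

theorem input_numClauses : RAM.input φ.code 0 (φ.numVars + 2) = φ.numClauses := by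
  simp [RAM.input, code, List.getD_eq_getElem?_getD]

theorem input_literal (k : Fin (φ.numClauses * 3)) :
    RAM.input φ.code 0 (φ.numVars + 3 + k) = codeLiteral (φ.clause k.divNat k.modNat) := by
  have h : φ.numVars + 3 + k = φ.numVars + k + 1 + 1 + 1 := by omega
  simp only [RAM.input, if_true, code, h, List.getD_cons_succ]
  rw [List.getD_append_right _ _ _ _ (by simp; omega)]
  have h' : φ.numVars + (k : ℕ) + 1 - (List.range φ.numVars).length = k + 1 := by simp; omega
  rw [h', List.getD_cons_succ, List.getD_eq_getElem _ _ (by simp)]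
  simp

theorem input_bounded {M : ℕ} (hM : 2 + 2 * φ.numVars + φ.numClauses * 3 ≤ M) :
    (RAM.input φ.code).Bounded M := by
  intro a i
  unfold RAM.input
  split_ifs
  · rcases i with _ | i
    · rw [List.getD_cons_zero, length_code]
      omega
    · rw [List.getD_cons_succ]
      by_cases hi : i < φ.code.length
      · rw [List.getD_eq_getElem _ _ hi]
        have := φ.mem_code_le (List.getElem_mem hi)
        omega
      · rw [List.getD_eq_default _ _ (by omega)]
        omega
  · omega

end ThreeCNF

namespace WeightedBipartite

theorem length_code (G : WeightedBipartite) : G.code.length = G.side * G.side + 1 := by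
  simp [code]

end WeightedBipartite

theorem code_familyGraph_getElem_succ {r N q : ℕ} (F : ℕ → ℕ) (e : ℕ)
    (h : e + 1 < (familyGraph r N q F).code.length) :
    (familyGraph r N q F).code[e + 1] = edgeWeight r N q F (e / (q * q)) (e % (q * q)) := by
  simp [WeightedBipartite.code, familyGraph]

/-! ### The main program and its weight tables. -/

namespace RAM

/-- Two consecutive blocks in the output array present the codes of two family graphs. -/
theorem isOutput_code {s : Store} {r N q r' N' q' : ℕ} {F F' : ℕ → ℕ}
    (h0 : s 1 0 = 1 + q * q * (q * q) + 1 + q' * q' * (q' * q'))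
    (h1 : s 1 1 = q * q)
    (h2 : ∀ e < q * q * (q * q),
      s 1 (2 + e) = edgeWeight r N q F (e / (q * q)) (e % (q * q)))
    (h3 : s 1 (1 + q * q * (q * q) + 1) = q' * q')
    (h4 : ∀ e < q' * q' * (q' * q'), s 1 (1 + q * q * (q * q) + 2 + e) =
      edgeWeight r' N' q' F' (e / (q' * q')) (e % (q' * q'))) :
    IsOutput s ((familyGraph r N q F).code ++ (familyGraph r' N' q' F').code) := by
  have l1 : (familyGraph r N q F).code.length = q * q * (q * q) + 1 :=
    WeightedBipartite.length_code _
  have l2 : (familyGraph r' N' q' F').code.length = q' * q' * (q' * q') + 1 :=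
    WeightedBipartite.length_code _
  refine ⟨by rw [h0, List.length_append, l1, l2]; omega, fun i hi => ?_⟩
  rw [List.length_append, l1, l2] at hi
  by_cases hlt : i < q * q * (q * q) + 1
  · rw [List.getElem_append_left (by omega)]
    rcases i with _ | e
    · exact h1
    · rw [code_familyGraph_getElem_succ, ← h2 e (by omega)]
      congr 1
      omega
  · obtain ⟨j, rfl⟩ : ∃ j, i = q * q * (q * q) + 1 + j := ⟨i - (q * q * (q * q) + 1), by omega⟩
    rw [List.getElem_append_right (by omega)]
    simp only [l1, Nat.add_sub_cancel_left]
    rcases j with _ | e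
    · rw [show q * q * (q * q) + 1 + 0 + 1 = 1 + q * q * (q * q) + 1 by omega, h3]
      rfl
    · rw [code_familyGraph_getElem_succ, ← h4 e (by omega)]
      congr 1
      omega

open Term Program

/-- Further variables: `16` holds the number of clauses, `17` is a loop counter, and `18` holds a
power of two. -/
def literalBody : Program := block
  [.write 2 (.read 0 (var 3 + const 3 + var 17))
      (.read 2 (.read 0 (var 3 + const 3 + var 17)) + var 18),
    assign 18 (var 18 * const 2), assign 17 (var 17 + const 1)]

def octalBody : Program := block
  [.write 2 (var 17) (var 18 * ((var 17).mod (const 7) + const 1)),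
    assign 18 (var 18 * (const 1 + const 7 * (((var 17).mod (const 7) + const 1) / const 7))),
    assign 17 (var 17 + const 1)]

def literalInit : Program := block
  [assign 3 (.read 0 (const 1)), assign 16 (.read 0 (var 3 + const 2)), assign 4 (const 2),
    assign 17 (const 0), assign 18 (const 1)]

def octalInit : Program := block
  [assign 3 (var 16), assign 4 (const 7), assign 17 (const 0), assign 18 (const 1)]

def literalPhase : Program := block
  [literalInit, .whileDo (var 16 * const 3 - var 17) literalBody, search, matrix]

def octalPhase : Program := block
  [octalInit, .whileDo (var 16 * const 7 - var 17) octalBody, search, matrix]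

def mainProgram : Program := block [literalPhase, octalPhase, .write 1 (const 0) (var 15)]

variable {M : ℕ}

theorem halts_literal {s : Store} {n L : ℕ} (hs : s.Bounded M) (hM : 2 ^ L + L ≤ M)
    (h16 : s 16 0 * 3 = L) (h3 : s 3 0 = n) (h17 : s 17 0 = 0) (h18 : s 18 0 = 1)
    (h2 : ∀ c, s 2 c = 0) :
    Halts M (.whileDo (var 16 * const 3 - var 17) literalBody) s ((L + 1) * 150) fun s' =>
      ∀ c, s' 2 c = ∑ k ∈ Finset.range L, if s 0 (n + 3 + k) = c then 2 ^ k else 0 := by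
  -- Distinct powers of two: partial table entries stay below `2 ^ k`, hence within the memory
  -- bound.
  have hlt : ∀ k c, (∑ j ∈ Finset.range k, if s 0 (n + 3 + j) = c then 2 ^ j else 0) < 2 ^ k := by
    intro k c
    refine lt_of_le_of_lt (Finset.sum_le_sum (g := fun j => 2 ^ j) fun j _ => ?_)
      (Nat.geomSum_lt (le_refl 2) fun j hj => Finset.mem_range.1 hj)
    split_ifs <;> simp
  refine (Halts.whileDo (T := literalBody.weight) (fun k s' => s' 17 0 = k ∧ s' 18 0 = 2 ^ k ∧
    ∀ c, s' 2 c = ∑ j ∈ Finset.range k, if s 0 (n + 3 + j) = c then 2 ^ j else 0) L hs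
    ?_ ?_ ?_).mono (Nat.mul_le_mul_left _ (by decide)) fun s' _ h => h.2.2
  · simp [h17, h18, h2]
  · rintro k hk s' ⟨e17, -, -⟩ hf
    have e16 : s' 16 0 * 3 = L := by
      rw [hf 16 (by simp [literalBody, block, Writes]), h16]
    simp only [eval_sub, eval_mul, eval_read, eval_const, e16, e17]
    omega
  · rintro k hk s' hs' ⟨e17, e18, e2⟩ hf
    have e3 : s' 3 0 = n := by rw [hf 3 (by simp [literalBody, block, Writes]), h3]
    have e0 : s' 0 = s 0 := hf 0 (by simp [literalBody, block, Writes])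
    have hpow : 2 ^ (k + 1) ≤ 2 ^ L := Nat.pow_le_pow_right (by norm_num) hk
    have hsum := hlt k (s 0 (n + 3 + k))
    have hpow' : 2 ^ (k + 1) = 2 ^ k * 2 := pow_succ 2 k
    refine halts_of_wp hs' ?_
    simp only [literalBody, block, wp, eval_add, eval_mul, eval_read, eval_const, Store.set_apply,
      e0, e3, e17, e18, e2]
    refine ⟨by omega, by simp; omega, by simp; omega, by simp, by simp [pow_succ], fun c => ?_⟩
    rw [Finset.sum_range_succ]
    by_cases hc : c = s 0 (n + 3 + k)
    · subst hc
      simp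
    · simp [hc, Ne.symm hc]

/-- The running power is multiplied by 8 exactly when the index leaves a group of seven. -/
theorem eight_pow_succ_div (k : ℕ) :
    8 ^ (k / 7) * (1 + 7 * ((k % 7 + 1) / 7)) = 8 ^ ((k + 1) / 7) := by
  by_cases h : k % 7 = 6
  · have h1 : (k + 1) / 7 = k / 7 + 1 := by omega
    rw [h1, h, pow_succ]
  · have h1 : (k + 1) / 7 = k / 7 := by omega
    have h2 : (k % 7 + 1) / 7 = 0 := by omega
    rw [h1, h2]
    omega

theorem octalWeight_lt {m u : ℕ} (hu : u < m * 7) : octalWeight u < 8 ^ m := by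
  have h1 : 8 ^ (u / 7 + 1) ≤ 8 ^ m := Nat.pow_le_pow_right (by norm_num) (by omega)
  refine lt_of_lt_of_le ?_ h1
  rw [pow_succ, octalWeight]
  exact Nat.mul_lt_mul_of_pos_left (by omega) (by positivity)

/-- Cells from `m * 7` on may keep literal weights; only their size is controlled. -/
theorem halts_octal {s : Store} {m : ℕ} (hs : s.Bounded M) (hM : 8 ^ m + m * 7 ≤ M)
    (h16 : s 16 0 = m) (h17 : s 17 0 = 0) (h18 : s 18 0 = 1) (h2 : ∀ c, s 2 c ≤ 8 ^ m) :
    Halts M (.whileDo (var 16 * const 7 - var 17) octalBody) s ((m * 7 + 1) * 1000) fun s' =>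
      (∀ c < m * 7, s' 2 c = octalWeight c) ∧ ∀ c, s' 2 c ≤ 8 ^ m := by
  refine (Halts.whileDo (T := octalBody.weight) (fun k s' => s' 17 0 = k ∧ s' 18 0 = 8 ^ (k / 7) ∧
    (∀ c < k, s' 2 c = octalWeight c) ∧ ∀ c, s' 2 c ≤ 8 ^ m) (m * 7) hs
    ?_ ?_ ?_).mono (Nat.mul_le_mul_left _ (by decide)) fun s' _ h => h.2.2
  · exact ⟨h17, by simp [h18], by simp, h2⟩
  · rintro k hk s' ⟨e17, -, -⟩ hf
    have e16 : s' 16 0 = m := by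
      rw [hf 16 (by simp [octalBody, block, Writes]), h16]
    simp only [eval_sub, eval_mul, eval_read, eval_const, e16, e17]
    omega
  · rintro k hk s' hs' ⟨e17, e18, e2, e2'⟩ hf
    have hlt := octalWeight_lt hk
    have hpow : 8 ^ ((k + 1) / 7) ≤ 8 ^ m := Nat.pow_le_pow_right (by norm_num) (by omega)
    have hoct : 8 ^ (k / 7) * (k % 7 + 1) = octalWeight k := rfl
    refine halts_of_wp hs' ?_
    simp only [octalBody, block, wp, eval_add, eval_mul, eval_div, eval_mod, eval_read, eval_const,
      Store.set_apply, e17, e18, and_self, and_true, true_and, Nat.reduceEqDiff, reduceIte,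
      false_and, eight_pow_succ_div, hoct]
    refine ⟨by omega, by omega, by omega, fun c hc => ?_, fun c => ?_⟩
    · split_ifs with h
      · rw [h]
      · exact e2 c (by omega)
    · split_ifs with h
      · omega
      · exact e2' c

-- Total running time.

end RAM

namespace RAM

open Term Program

theorem eq_of_writes_search {b : ℕ} (h : search.Writes b) : 5 ≤ b ∧ b ≤ 10 := by
  simp only [search, searchBody, searchInit, countDivisorsBody, logInit, logBody, testAdmissible,
    block, Writes] at h
  omega

theorem eq_of_writes_matrix {b : ℕ} (h : matrix.Writes b) :
    b = 1 ∨ 11 ≤ b ∧ b ≤ 15 ∨ 19 ≤ b := by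
  simp only [matrix, matrixInit, matrixBody, edgeInit, edgeBody, edgeOutput, block, Writes] at h
  omega

theorem halts_literalPhase (φ : ThreeCNF) {Y M : ℕ}
    (hY : 16 * (2 + φ.numVars + φ.numClauses * 3) ≤ Y)
    (hM : Y ^ 5 * (8 ^ φ.numClauses + 1) ≤ M) {q : ℕ} (hq : q = planeOrder 2 φ.numVars) :
    Halts M literalPhase (input φ.code) (4000 * Y ^ 5) fun s =>
      s 15 0 = 1 + q * q * (q * q) ∧ s 16 0 = φ.numClauses ∧ (∀ c, s 2 c ≤ 8 ^ φ.numClauses) ∧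
      s 1 1 = q * q ∧ ∀ e < q * q * (q * q),
        s 1 (2 + e) = edgeWeight 2 φ.numVars q φ.literalWeight (e / (q * q)) (e % (q * q)) := by
  set n := φ.numVars with hn
  set m := φ.numClauses with hm
  have hYM : Y ^ 5 + Y ^ 5 * 8 ^ m ≤ M := by rw [mul_add, mul_one] at hM; omega
  have hY5 : 14 * Y ^ 4 ≤ Y ^ 5 := by
    rw [pow_succ' Y 4]
    exact Nat.mul_le_mul_right _ (by omega)
  have hY4 : Y ≤ Y ^ 4 := Nat.le_self_pow (by norm_num) Y
  have h8 : 8 ^ m ≤ Y ^ 5 * 8 ^ m := Nat.le_mul_of_pos_left _ (by omega)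
  have h8' : 2 ^ (m * 3) = 8 ^ m := by rw [mul_comm, pow_mul]; norm_num
  have hqle : q ≤ 2 * n + 14 := hq ▸ planeOrder_le n le_rfl (by norm_num)
  have hqpos : 0 < q := hq ▸ (isAdmissible_planeOrder n le_rfl (by norm_num)).1.pos
  have hs₀ : (input φ.code).Bounded M := φ.input_bounded (by omega)
  have hzero : ∀ a i, a ≠ 0 → input φ.code a i = 0 := fun a i ha => by simp [input, ha]
  refine Halts.mono (T := literalInit.weight + ((m * 3 + 1) * 150 + (2000 * Y ^ 2 +
    1000 * Y ^ 5 + 1) + 1) + 1) ?_ ?_ fun _ _ h => h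
  · refine Halts.seq (Q := fun s => s 3 0 = n ∧ s 16 0 = m ∧ s 4 0 = 2 ∧ s 17 0 = 0 ∧ s 18 0 = 1)
      (halts_of_wp hs₀ ?_) ?_
    · have h1 := φ.input_numVars
      have h2 := φ.input_numClauses
      rw [← hn] at h1 h2
      rw [← hm] at h2
      simp only [literalInit, block, wp, eval_add, eval_read, eval_const, Store.set_apply]
      simp [h1, h2]
      omega
    rintro s₁ hs₁ ⟨a3, a16, a4, a17, a18⟩ hf₁
    have hmem₁ : ∀ b, b = 0 ∨ b = 1 ∨ b = 2 ∨ b = 15 → s₁ b = input φ.code b := by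
      rintro b (rfl | rfl | rfl | rfl) <;> exact hf₁ _ (by simp [literalInit, block, Writes])
    refine (halts_literal (n := n) (L := m * 3) hs₁ (by omega) (by omega) a3 a17 a18
      fun c => (congrFun (hmem₁ 2 (by simp)) c).trans (hzero 2 c (by norm_num))).seq ?_
    rintro s₂ hs₂ b2 hf₂
    have hmem₂ : ∀ b, b ≠ 2 → b ≠ 17 → b ≠ 18 → s₂ b = s₁ b :=
      fun b h h' h'' => hf₂ b (by simp [literalBody, block, Writes, h, h', h''])
    have b2' : s₂ 2 = φ.literalWeight := by
      funext c
      rw [b2 c, ← Fin.sum_univ_eq_sum_range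
        (fun k => if s₁ 0 (n + 3 + k) = c then 2 ^ k else 0), ThreeCNF.literalWeight]
      refine Finset.sum_congr rfl fun k _ => ?_
      rw [hmem₁ 0 (by simp), hn, φ.input_literal k]
    have hB : ∀ c, φ.literalWeight c ≤ 8 ^ m := by
      intro c
      rw [← congrFun b2' c, b2 c, ← h8']
      refine (Finset.sum_le_sum (g := fun j => 2 ^ j) fun j _ => ?_).trans
        (Nat.geomSum_lt (le_refl 2) fun j hj => Finset.mem_range.1 hj).le
      split_ifs <;> simp
    refine (halts_search (N := n) (Y := Y) hs₂ (le_refl 2) (by norm_num) (by omega) (by omega)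
      (by rw [hmem₂ 3 (by simp) (by simp) (by simp), a3])
      (by rw [hmem₂ 4 (by simp) (by simp) (by simp), a4])).seq ?_
    rw [← hq]
    rintro s₃ hs₃ ⟨c5, c9⟩ hf₃
    have hmem₃ : ∀ b, b < 5 ∨ 10 < b → s₃ b = s₂ b := fun b hb =>
      hf₃ b fun h => by have := eq_of_writes_search h; omega
    have c15 : s₃ 15 0 = 0 := by
      rw [hmem₃ 15 (by simp), hmem₂ 15 (by simp) (by simp) (by simp), hmem₁ 15 (by simp)]
      exact hzero _ _ (by norm_num)
    refine (halts_matrix (N := n) (Y := Y) hs₃ hB hqpos (by omega) (by omega) (Nat.zero_le _) hM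
      ((hmem₃ 2 (by simp)).trans b2')
      (by rw [hmem₃ 3 (by simp), hmem₂ 3 (by simp) (by simp) (by simp), a3])
      (by rw [hmem₃ 4 (by simp), hmem₂ 4 (by simp) (by simp) (by simp), a4])
      c5 c9 c15).frame.mono le_rfl ?_
    rintro s₄ hs₄ ⟨⟨d15, d1, d1', -⟩, hf₄⟩
    have hmem₄ : ∀ b, b = 2 ∨ b = 16 → s₄ b = s₂ b := by
      intro b hb
      rw [hf₄ b fun h => by have := eq_of_writes_matrix h; omega, hmem₃ b (by omega)]
    rw [Nat.zero_add] at d15 d1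
    simp only [Nat.zero_add] at d1'
    refine ⟨d15, ?_, fun c => ?_, d1, d1'⟩
    · rw [hmem₄ 16 (by simp), hmem₂ 16 (by simp) (by simp) (by simp), a16]
    · rw [hmem₄ 2 (by simp), b2']
      exact hB c
  · have h1 : literalInit.weight ≤ 150 := by decide
    have h4 : Y ^ 2 ≤ Y ^ 5 := Nat.pow_le_pow_right (by omega) (by norm_num)
    omega

theorem halts_octalPhase {s : Store} {m P Y M : ℕ} (hs : s.Bounded M) (hY : 32 + 48 * m ≤ Y)
    (hP : P ≤ Y ^ 4) (hM : Y ^ 5 * (8 ^ m + 1) ≤ M) {q : ℕ} (hq : q = planeOrder 7 m)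
    (h16 : s 16 0 = m) (h15 : s 15 0 = P) (h2 : ∀ c, s 2 c ≤ 8 ^ m) :
    Halts M octalPhase s (4000 * Y ^ 5) fun s' => s' 15 0 = P + 1 + q * q * (q * q) ∧
      s' 1 (P + 1) = q * q ∧ (∀ e < q * q * (q * q),
        s' 1 (P + 2 + e) = edgeWeight 7 m q octalWeight (e / (q * q)) (e % (q * q))) ∧
      ∀ x ≤ P, s' 1 x = s 1 x := by
  have hYM : Y ^ 5 + Y ^ 5 * 8 ^ m ≤ M := by rw [mul_add, mul_one] at hM; omega
  have hY5 : 14 * Y ^ 4 ≤ Y ^ 5 := by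
    rw [pow_succ' Y 4]
    exact Nat.mul_le_mul_right _ (by omega)
  have hY4 : Y ≤ Y ^ 4 := Nat.le_self_pow (by norm_num) Y
  have h8 : 8 ^ m ≤ Y ^ 5 * 8 ^ m := Nat.le_mul_of_pos_left _ (by omega)
  have hqle : q ≤ 2 * m + 14 := hq ▸ planeOrder_le m (by norm_num) le_rfl
  have hqpos : 0 < q := hq ▸ (isAdmissible_planeOrder m (by norm_num) le_rfl).1.pos
  refine Halts.mono (T := octalInit.weight + ((m * 7 + 1) * 1000 + (2000 * Y ^ 2 +
    1000 * Y ^ 5 + 1) + 1) + 1) ?_ ?_ fun _ _ h => h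
  · refine Halts.seq (Q := fun s => s 3 0 = m ∧ s 4 0 = 7 ∧ s 17 0 = 0 ∧ s 18 0 = 1)
      (halts_of_wp hs ?_) ?_
    · simp only [octalInit, block, wp, eval_read, eval_const, Store.set_apply]
      simp [h16]
      omega
    rintro s₁ hs₁ ⟨a3, a4, a17, a18⟩ hf₁
    have hmem₁ : ∀ b, b = 1 ∨ b = 2 ∨ b = 15 ∨ b = 16 → s₁ b = s b := by
      rintro b (rfl | rfl | rfl | rfl) <;> exact hf₁ _ (by simp [octalInit, block, Writes])
    refine (halts_octal (m := m) hs₁ (by omega) (by rw [hmem₁ 16 (by simp), h16])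
      a17 a18 (fun c => by rw [hmem₁ 2 (by simp)]; exact h2 c)).seq ?_
    rintro s₂ hs₂ ⟨b2, b2'⟩ hf₂
    have hmem₂ : ∀ b, b ≠ 2 → b ≠ 17 → b ≠ 18 → s₂ b = s₁ b :=
      fun b h h' h'' => hf₂ b (by simp [octalBody, block, Writes, h, h', h''])
    refine (halts_search (N := m) (Y := Y) hs₂ (by norm_num : 2 ≤ 7) le_rfl (by omega) (by omega)
      (by rw [hmem₂ 3 (by simp) (by simp) (by simp), a3])
      (by rw [hmem₂ 4 (by simp) (by simp) (by simp), a4])).seq ?_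
    rw [← hq]
    rintro s₃ hs₃ ⟨c5, c9⟩ hf₃
    have hmem₃ : ∀ b, b < 5 ∨ 10 < b → s₃ b = s₂ b := fun b hb =>
      hf₃ b fun h => by have := eq_of_writes_search h; omega
    have hmem₃' : ∀ b, b = 1 ∨ b = 15 → s₃ b = s b := by
      intro b hb
      rw [hmem₃ b (by omega), hmem₂ b (by omega) (by omega) (by omega), hmem₁ b (by omega)]
    refine (halts_matrix (N := m) (Y := Y) hs₃ (fun c => by rw [hmem₃ 2 (by simp)]; exact b2' c)
      hqpos (by omega) (by omega) hP hM rfl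
      (by rw [hmem₃ 3 (by simp), hmem₂ 3 (by simp) (by simp) (by simp), a3])
      (by rw [hmem₃ 4 (by simp), hmem₂ 4 (by simp) (by simp) (by simp), a4]) c5 c9
      (by rw [hmem₃' 15 (by simp), h15])).mono le_rfl ?_
    rintro s₄ hs₄ ⟨d15, d1, d1', d1''⟩
    refine ⟨d15, d1, fun e he => (d1' e he).trans ?_, fun x hx => ?_⟩
    · refine edgeWeight_congr (by norm_num) (fun c hc => ?_) _ _
      rw [hmem₃ 2 (by simp)]
      exact b2 c (by omega)
    · rw [d1'' x hx, hmem₃' 1 (by simp)]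
  · have h1 : octalInit.weight ≤ 100 := by decide
    have h4 : Y ^ 2 ≤ Y ^ 5 := Nat.pow_le_pow_right (by omega) (by norm_num)
    omega

theorem halts_mainProgram (φ : ThreeCNF) {Y M : ℕ}
    (hY : 16 * (2 + φ.numVars + φ.numClauses * 3) ≤ Y)
    (hM : Y ^ 5 * (8 ^ φ.numClauses + 1) ≤ M) :
    Halts M mainProgram (input φ.code) (10000 * Y ^ 5) fun s =>
      IsOutput s (reduction φ).code := by
  change Halts M mainProgram (input φ.code) (10000 * Y ^ 5) fun s =>
    IsOutput s ((familyGraph 2 φ.numVars (planeOrder 2 φ.numVars) φ.literalWeight).code ++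
      (familyGraph 7 φ.numClauses (planeOrder 7 φ.numClauses) octalWeight).code)
  have hqle := planeOrder_le φ.numVars (le_refl 2) (by norm_num)
  obtain ⟨q, hq⟩ : ∃ q, q = planeOrder 2 φ.numVars := ⟨_, rfl⟩
  obtain ⟨q', hq'⟩ : ∃ q', q' = planeOrder 7 φ.numClauses := ⟨_, rfl⟩
  rw [← hq, ← hq']
  rw [← hq] at hqle
  have hP : 1 + q * q * (q * q) ≤ Y ^ 4 := by
    have h1 : q * q + 1 ≤ Y * Y := by nlinarith [(by omega : q + 1 ≤ Y)]
    calc 1 + q * q * (q * q) ≤ (q * q + 1) * (q * q + 1) := by nlinarith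
      _ ≤ Y * Y * (Y * Y) := Nat.mul_le_mul h1 h1
      _ = Y ^ 4 := by ring
  have hw : (Program.write 1 (const 0) (var 15)).weight ≤ 50 := by decide
  have hYY : Y ≤ Y ^ 5 := Nat.le_self_pow (by norm_num) Y
  refine Halts.mono (T := 4000 * Y ^ 5 + (4000 * Y ^ 5 +
    (Program.write 1 (const 0) (var 15)).weight + 1) + 1) ?_ (by omega) fun _ _ h => h
  refine (halts_literalPhase φ hY hM hq).seq ?_
  rintro s₁ hs₁ ⟨a15, a16, a2, a1, a1'⟩ -
  refine (halts_octalPhase hs₁ (by omega) hP hM hq' a16 a15 a2).seq ?_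
  rintro s₂ hs₂ ⟨b15, b1, b1', b1''⟩ -
  have hset : ∀ v x, s₂.set 1 0 v 1 (x + 1) = s₂ 1 (x + 1) := fun v x => by
    simp [Store.set_apply]
  refine halts_of_wp hs₂ ⟨hs₂ 15 0, isOutput_code ?_ ?_ ?_ ?_ ?_⟩
  · simp [Store.set_apply, b15]
  · exact (hset _ 0).trans ((b1'' 1 (by omega)).trans a1)
  · intro e he
    rw [← a1' e he, ← b1'' _ (by omega), show 2 + e = 1 + e + 1 by omega]
    exact hset _ _
  · exact (hset _ _).trans b1
  · intro e he
    rw [← b1' e he, show 1 + q * q * (q * q) + 2 + e = 1 + q * q * (q * q) + 1 + e + 1 by omega]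
    exact hset _ _

/-- The memory bound `M` is exponential in the number of clauses but has bit length linear in the
input size `S`. Of the exponent 6, five come from the number of cost units and one from the bit
length charged per unit. -/
theorem polyTimeComputable_reduction :
    PolyTimeComputable ThreeCNF.code CommonMatchingWeight.code reduction := by
  refine ⟨mainProgram, Polynomial.C (70000 * 16 ^ 6) * Polynomial.X ^ 6, fun φ => ?_⟩
  set S := bitSize φ.code with hS
  have hlen := length_le_bitSize φ.code
  rw [φ.length_code, ← hS] at hlen
  set m := φ.numClauses
  set M := (16 * S) ^ 5 * (8 ^ m + 1) with hM
  obtain ⟨t, s, h1, h2, -, h4⟩ := halts_mainProgram φ (Nat.mul_le_mul_left 16 hlen) le_rfl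
  refine ⟨t, s, h1, h4, h2.trans ?_⟩
  have hsize : M.size + 2 ≤ 7 * (16 * S) := by
    have : M.size ≤ 5 * (16 * S) + (3 * m + 1) := by
      rw [Nat.size_le, pow_add, mul_comm 5, pow_mul]
      refine Nat.mul_lt_mul_of_lt_of_le (Nat.pow_lt_pow_left Nat.lt_two_pow_self (by norm_num))
        ?_ (by positivity)
      have h8 : 2 ^ (3 * m) = 8 ^ m := by rw [pow_mul]; norm_num
      have : 1 ≤ 8 ^ m := Nat.one_le_pow _ _ (by norm_num)
      rw [pow_succ, h8]
      omega
    omega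
  rw [Polynomial.eval_mul, Polynomial.eval_C, Polynomial.eval_pow, Polynomial.eval_X]
  calc 10000 * (16 * S) ^ 5 * (M.size + 2) ≤ 10000 * (16 * S) ^ 5 * (7 * (16 * S)) :=
        Nat.mul_le_mul_left _ hsize
    _ = 70000 * 16 ^ 6 * S ^ 6 := by ring

end RAM

/-! ### Assembly of the theorem. -/

theorem mainTheorem4 :
    ∃ R : ThreeCNF → CommonMatchingWeight,
      IsPolyTimeReduction ThreeCNF.code ThreeCNF.Satisfiable
        CommonMatchingWeight.code CommonMatchingWeight.IsYes R ∧
      (∃ C : ℝ, ∀ φ : ThreeCNF,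
        (2 ≤ φ.numVars →
          ((R φ).G₁.numVertices : ℝ) ≤ C * (φ.numVars / Real.log φ.numVars)) ∧
        (φ.numVars < 2 → ((R φ).G₁.numVertices : ℝ) ≤ C) ∧
        (2 ≤ φ.numClauses →
          ((R φ).G₂.numVertices : ℝ) ≤ C * (φ.numClauses / Real.log φ.numClauses)) ∧
        (φ.numClauses < 2 → ((R φ).G₂.numVertices : ℝ) ≤ C)) ∧
      (∀ φ : ThreeCNF,
        (∀ M, (R φ).G₁.IsPerfectMatching M →
          (R φ).G₁.matchingWeight M < 2 ^ (3 * φ.numClauses)) ∧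
        (∀ M, (R φ).G₂.IsPerfectMatching M →
          (R φ).G₂.matchingWeight M < 2 ^ (3 * φ.numClauses))) ∧
      (∀ φ : ThreeCNF,
        ∃ (f : Fin φ.numVars → Fin 2 → ℕ) (g : Fin φ.numClauses → Fin 7 → ℕ),
          (φ.Satisfiable ↔ (family f ∩ family g).Nonempty) ∧
          (R φ).G₁.matchingWeights = family f ∧
          (R φ).G₂.matchingWeights = family g) := by
  refine ⟨reduction, ⟨RAM.polyTimeComputable_reduction, reduction_isYes_iff⟩,
    ⟨20000, fun φ => ?_⟩, fun φ => ⟨fun M hM => ?_, fun M hM => ?_⟩,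
    fun φ => ⟨φ.literalFamily, φ.clauseFamily, φ.satisfiable_iff, reduction_matchingWeights φ⟩⟩
  · obtain ⟨h1, h2⟩ := exists_numVertices_le (le_refl 2) (by norm_num) φ.numVars
    obtain ⟨h3, h4⟩ := exists_numVertices_le (by norm_num : 2 ≤ 7) le_rfl φ.numClauses
    exact ⟨h1, h2, h3, h4⟩
  · refine φ.literalFamily_lt ?_
    rw [← (reduction_matchingWeights φ).1]
    exact ⟨M, hM, rfl⟩
  · refine φ.clauseFamily_lt ?_
    rw [← (reduction_matchingWeights φ).2]
    exact ⟨M, hM, rfl⟩
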